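/- Setting. Let $n\ge 2$, $\mathcal H=(\mathbb C^2)^{\otimes n}$, with fermionic annihilation operators $a_p=\big(\prod_{q<p}Z_q\big)\,|0\rangle\langle 1|_p$, Majorana operators $\gamma_{2p}=a_p+a_p^\dagger$, $\gamma_{2p+1}=-i(a_p-a_p^\dagger)$, and $\Gamma_\mu=(-i)^{\binom{|\mu|}{2}}\prod_{m\in\mu}\gamma_m$ (ascending order) for $\mu\subseteq\{0,\dots,2n-1\}$. Let $N=\sum_p a_p^\dagger a_p$, $\Pi_m(X)=2^{-n}\sum_{|\mu|=m}\mathrm{tr}(\Gamma_\mu^\dagger X)\Gamma_\mu$, $\mathcal M_Z(X)=\sum_b|b\rangle\langle b|X|b\rangle\langle b|$, $f_m=\mathrm{tr}(\mathcal M_Z\Pi_m)/\mathrm{tr}(\Pi_m)$ and $\mathcal M^{-1}=\sum_{m:\,f_m\neq 0}f_m^{-1}\Pi_m$. For $Q\in\mathrm O(2n)$ let $U_Q$ be the unitary (unique up to phase) with $U_Q\gamma_mU_Q^\dagger=\sum_l Q_{lm}\gamma_l$. Let $G$ be a closed group with $\mathrm B(2n)\subseteq G\subseteq\mathrm O(2n)$,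 where $\mathrm B(2n)$ is the group of signed permutation matrices. Let $\mathcal E$ be a completely positive trace-preserving map on $n$ modes and put $$F_{Z,\{2,4\}}(\mathcal E)=\min_{\lambda\in\{2,4\}}\frac{\mathrm{tr}(\mathcal E\mathcal M_Z\Pi_\lambda)}{\mathrm{tr}(\mathcal M_Z\Pi_\lambda)}.$$ Experiment and estimator. For a state $\rho$, draw $T$ independent pairs $(Q_\ell,b_\ell)$, with $Q_\ell$ Haar distributed on $G$ and $b_\ell$ having conditional probability $\langle b|\mathcal E(U_{Q_\ell}\rho U_{Q_\ell}^\dagger)|b\rangle$. Let $\hat\rho(T)=\frac1T\sum_\ell\mathcal M^{-1}(U_{Q_\ell}^\dagger|b_\ell\rangle\langle b_\ell|U_{Q_\ell})$. With $S_2=\Pi_2(N)$, $S_4=\Pi_4(N^2)$, $s_2=\eta-\frac n2$ and $s_4=\frac12\binom n2-\eta(n-\eta)$, put $$\hat o_\mu(T)=\frac{\mathrm{tr}(\Gamma_\mu\hat\rho(T))}{\mathrm{tr}(S_\lambda\hat\rho(T))/s_\lambda},\qquad \lambda=|\mu|\in\{2,4\}.$$ Theorem (fermions with particle-number symmetry).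 There is a universal constant $K$, and for every $c>0$ there is a constant $C>0$ depending only on $c$, such that the following holds for all $n\ge2$, all $G$ as above, every state $\rho$ on $n$ modes with exactly $\eta$ particles ($N\rho=\eta\rho$) for which $|s_2|\ge cn$ and $s_4\ne0$, and every noise channel $\mathcal E$ with $F_{Z,\{2,4\}}(\mathcal E)>0$. First, $\mathrm{tr}(S_2\rho)=s_2$ and $\mathrm{tr}(S_4\rho)=s_4$, so these values are known a priori. Second, for all $\epsilon,\delta\in(0,1)$, if $$T\ \ge\ C\,n^2\,\log(n/\delta)\,\epsilon^{-2}\,F_{Z,\{2,4\}}(\mathcal E)^{-2},$$ then with probability at least $1-\delta$, simultaneously for all one- and two-body Majorana operators $\Gamma_\mu$, $|\mu|\in\{2,4\}$, $$\big|\hat o_\mu(T)-\mathrm{tr}(\Gamma_\mu\rho)\big|\le\epsilon+K\epsilon^2 .$$ In particular $T=O\big(n^2\log(n)\,\epsilon^{-2}F_{Z,\{2,4\}}(\mathcal E)^{-2}\big)$ samples suffice for success probability $1-1/\mathrm{poly}(n)$. -/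

import Mathlib

open MeasureTheory
open scoped ComplexOrder

namespace FermionShadow

noncomputable section

/-! ### Fermionic Fock space under the Jordan–Wigner transformation -/

/-- Computational basis labels of `n` qubits. -/
abbrev Bits (n : ℕ) : Type := Fin n → Fin 2

/-- Operators on the Hilbert space `(ℂ²)^{⊗ n}`, as matrices in the computational basis. -/
abbrev Op (n : ℕ) : Type := Matrix (Bits n) (Bits n) ℂ

/-- The tensor product `A₀ ⊗ A₁ ⊗ ⋯ ⊗ Aₙ₋₁` of one-qubit operators. -/
def tensorOp {n : ℕ} (A : Fin n → Matrix (Fin 2) (Fin 2) ℂ) : Op n :=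
  Matrix.of fun x y => ∏ q, A q (x q) (y q)

/-- The one-qubit Pauli operator `Z`. -/
def pauliZ : Matrix (Fin 2) (Fin 2) ℂ := !![1, 0; 0, -1]

/-- The one-qubit operator `|0⟩⟨1|`. -/
def lowering : Matrix (Fin 2) (Fin 2) ℂ := !![0, 1; 0, 0]

/-- The annihilation operator `a_p = (∏_{q < p} Z_q) |0⟩⟨1|_p`. -/
def annih {n : ℕ} (p : Fin n) : Op n :=
  tensorOp fun q => if q < p then pauliZ else if q = p then lowering else 1

/-- The mode to which a Majorana index `2p` or `2p + 1` belongs. -/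
def mode {n : ℕ} (m : Fin (2 * n)) : Fin n := ⟨m.val / 2, by omega⟩

/-- Majorana operators `γ_{2p} = a_p + a_p†`, `γ_{2p+1} = -i (a_p - a_p†)`. -/
def gam {n : ℕ} (m : Fin (2 * n)) : Op n :=
  if m.val % 2 = 0 then annih (mode m) + (annih (mode m)).conjTranspose
  else (-Complex.I) • (annih (mode m) - (annih (mode m)).conjTranspose)

/-- `Γ_s = (-i)^{binom(|s|,2)} ∏_{m ∈ s} γ_m`, the product taken in ascending order. -/
def majorana {n : ℕ} (s : Finset (Fin (2 * n))) : Op n :=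
  ((-Complex.I) ^ (s.card.choose 2)) • ((s.sort).map gam).prod

/-- The particle-number operator `N = ∑_p a_p† a_p`. -/
def numberOp (n : ℕ) : Op n := ∑ p : Fin n, (annih p).conjTranspose * annih p

/-- Density operators. -/
def IsState {n : ℕ} (ρ : Op n) : Prop := ρ.PosSemidef ∧ ρ.trace = 1

/-! ### Superoperators -/

/-- Complete positivity: `id_k ⊗ Φ` maps positive semidefinite operators to such, for all `k`. -/
def IsCompletelyPositive {n : ℕ} (Φ : Op n →ₗ[ℂ] Op n) : Prop :=
  ∀ (k : ℕ) (X : Matrix (Fin k × Bits n) (Fin k × Bits n) ℂ), X.PosSemidef →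
    (Matrix.of fun (x y : Fin k × Bits n) =>
      Φ (Matrix.of fun i j => X (x.1, i) (y.1, j)) x.2 y.2).PosSemidef

/-- Quantum channels: completely positive, trace-preserving maps. -/
def IsChannel {n : ℕ} (Φ : Op n →ₗ[ℂ] Op n) : Prop :=
  IsCompletelyPositive Φ ∧ ∀ X, (Φ X).trace = X.trace

/-- `M_Z : X ↦ ∑_b |b⟩⟨b| X |b⟩⟨b|`. -/
def measZ (n : ℕ) : Op n →ₗ[ℂ] Op n :=
  (Matrix.diagonalLinearMap (Bits n) ℂ ℂ).comp (Matrix.diagLinearMap (Bits n) ℂ ℂ)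

/-- `Π_m : X ↦ 2^{-n} ∑_{|s| = m} tr(Γ_s† X) Γ_s`, the projector onto the span `V_m` of the
Majorana operators of degree `m`. -/
def irrepProj (n m : ℕ) : Op n →ₗ[ℂ] Op n :=
  ∑ s ∈ (Finset.univ : Finset (Fin (2 * n))).powersetCard m, ((2 : ℂ) ^ n)⁻¹ •
    ((Matrix.traceLinearMap (Bits n) ℂ ℂ).comp
      (LinearMap.mulLeft ℂ (majorana s).conjTranspose)).smulRight (majorana s)

/-- `f_m = tr(M_Z Π_m) / tr(Π_m)`, the eigenvalues of the noiseless shadow channel. -/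
def shadowEigenvalue (n m : ℕ) : ℂ :=
  LinearMap.trace ℂ (Op n) (measZ n ∘ₗ irrepProj n m) / LinearMap.trace ℂ (Op n) (irrepProj n m)

/-- The (pseudo)inverse `∑_m f_m⁻¹ Π_m` of the noiseless shadow channel `∑_m f_m Π_m`; the terms
with `f_m = 0` are dropped by the convention `0⁻¹ = 0`. -/
def shadowInverse (n : ℕ) : Op n →ₗ[ℂ] Op n :=
  ∑ m ∈ Finset.range (2 * n + 1), (shadowEigenvalue n m)⁻¹ • irrepProj n m

/-- `tr(E M_Z Π_m) / tr(M_Z Π_m)`; a real number for every channel `E`. -/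
def noiseRatio {n : ℕ} (E : Op n →ₗ[ℂ] Op n) (m : ℕ) : ℝ :=
  (LinearMap.trace ℂ (Op n) (E ∘ₗ measZ n ∘ₗ irrepProj n m) /
    LinearMap.trace ℂ (Op n) (measZ n ∘ₗ irrepProj n m)).re

/-- `F_{Z,{2,4}}(E)`. -/
def noiseStrength {n : ℕ} (E : Op n →ₗ[ℂ] Op n) : ℝ := min (noiseRatio E 2) (noiseRatio E 4)

/-! ### Fermionic Gaussian unitaries -/

/-- The orthogonal group `O(2n)`. -/
abbrev Orth (n : ℕ) : Type := Matrix.orthogonalGroup (Fin (2 * n)) ℝ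

/-- `U` implements `Q`: it is unitary and `U γ_m U† = ∑_l Q_{lm} γ_l`. This determines `U` up to
a phase. -/
def Implements {n : ℕ} (U : Op n) (Q : Matrix (Fin (2 * n)) (Fin (2 * n)) ℝ) : Prop :=
  U ∈ Matrix.unitaryGroup (Bits n) ℂ ∧
    ∀ m, U * gam m * U.conjTranspose = ∑ l, (Q l m : ℂ) • gam l

theorem tensorOp_mul {n : ℕ} (A B : Fin n → Matrix (Fin 2) (Fin 2) ℂ) :
    tensorOp A * tensorOp B = tensorOp fun q => A q * B q := by
  ext x y
  simp only [tensorOp, Matrix.mul_apply, Matrix.of_apply, ← Finset.prod_mul_distrib]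
  exact (Fintype.prod_sum (fun q (j : Fin 2) => A q (x q) j * B q j (y q))).symm

theorem tensorOp_conjTranspose {n : ℕ} (A : Fin n → Matrix (Fin 2) (Fin 2) ℂ) :
    (tensorOp A).conjTranspose = tensorOp fun q => (A q).conjTranspose := by
  ext x y
  simp [tensorOp, Matrix.conjTranspose_apply]

theorem tensorOp_one {n : ℕ} : tensorOp (fun _ : Fin n => 1) = 1 := by
  ext x y
  simp only [tensorOp, Matrix.of_apply, Matrix.one_apply]
  by_cases h : x = y
  · simp [h]
  · obtain ⟨q, hq⟩ := Function.ne_iff.1 h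
    rw [if_neg h]
    exact Finset.prod_eq_zero (Finset.mem_univ q) (by simp [hq])

theorem tensorOp_add_at {n : ℕ} (p : Fin n) (A B C : Fin n → Matrix (Fin 2) (Fin 2) ℂ)
    (h : ∀ q, q ≠ p → A q = C q ∧ B q = C q) (hp : A p + B p = C p) :
    tensorOp A + tensorOp B = tensorOp C := by
  ext x y
  simp only [tensorOp, Matrix.of_apply, Matrix.add_apply]
  rw [← Finset.mul_prod_erase _ _ (Finset.mem_univ p), ← Finset.mul_prod_erase _ _ (Finset.mem_univ p),
    ← Finset.mul_prod_erase Finset.univ (fun q => C q (x q) (y q)) (Finset.mem_univ p), ← hp,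
    Finset.prod_congr rfl (g := fun q => C q (x q) (y q)) fun q hq => by
      rw [(h q (Finset.ne_of_mem_erase hq)).1],
    Finset.prod_congr (f := fun q => B q (x q) (y q)) rfl (g := fun q => C q (x q) (y q)) fun q hq => by
      rw [(h q (Finset.ne_of_mem_erase hq)).2], Matrix.add_apply, add_mul]

theorem tensorOp_eq_zero {n : ℕ} (p : Fin n) (A : Fin n → Matrix (Fin 2) (Fin 2) ℂ)
    (hp : A p = 0) : tensorOp A = 0 := by
  ext x y
  exact Finset.prod_eq_zero (Finset.mem_univ p) (by simp [hp])

theorem pauliZ_conj : pauliZ.conjTranspose = pauliZ := by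
  ext i j; fin_cases i <;> fin_cases j <;> simp [pauliZ]

theorem lowering_conj : lowering.conjTranspose = !![0, 0; 1, 0] := by
  ext i j; fin_cases i <;> fin_cases j <;> simp [lowering]

theorem pauliZ_sq : pauliZ * pauliZ = 1 := by
  ext i j; fin_cases i <;> fin_cases j <;> simp [pauliZ]

/-- One-site anticommutation makes two tensor products anticommute. -/
theorem tensorOp_anticomm {n : ℕ} (p : Fin n) (A B : Fin n → Matrix (Fin 2) (Fin 2) ℂ)
    (h : ∀ q, q ≠ p → A q * B q = B q * A q) (hp : A p * B p + B p * A p = 0) :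
    tensorOp A * tensorOp B + tensorOp B * tensorOp A = 0 := by
  rw [tensorOp_mul, tensorOp_mul, tensorOp_add_at p _ _ (fun q => if q = p then 0 else A q * B q)]
  · exact tensorOp_eq_zero p _ (by simp)
  · intro q hq; simp [hq, h q hq]
  · simpa using hp

theorem annih_anticomm {n : ℕ} (p q : Fin n) :
    annih p * annih q + annih q * annih p = 0 := by
  have key : ∀ p q : Fin n, p < q → annih p * annih q + annih q * annih p = 0 := by
    intro p q hpq
    refine tensorOp_anticomm p _ _ ?_ ?_
    · intro r hr
      rcases lt_or_gt_of_ne hr with h | h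
      · simp [h, h.trans hpq]
      · simp [h.not_gt, hr]
    · ext i j
      fin_cases i <;> fin_cases j <;> simp [hpq, pauliZ, lowering]
  rcases lt_trichotomy p q with h | rfl | h
  · exact key p q h
  · have : annih p * annih p = 0 := by
      rw [annih, tensorOp_mul]
      exact tensorOp_eq_zero p _ (by ext i j; fin_cases i <;> fin_cases j <;> simp [lowering])
    simp [this]
  · rw [add_comm]; exact key q p h

theorem annih_conj_anticomm {n : ℕ} (p q : Fin n) :
    annih p * (annih q).conjTranspose + (annih q).conjTranspose * annih p =
      if p = q then 1 else 0 := by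
  have key : ∀ p q : Fin n, p < q →
      annih p * (annih q).conjTranspose + (annih q).conjTranspose * annih p = 0 := by
    intro p q hpq
    rw [annih, annih, tensorOp_conjTranspose]
    refine tensorOp_anticomm p _ _ ?_ ?_
    · intro r hr
      rcases lt_or_gt_of_ne hr with h | h
      · simp [h, h.trans hpq, pauliZ_conj]
      · simp [h.not_gt, hr]
    · simp only [lt_irrefl, if_false, if_true, hpq, pauliZ_conj]
      ext i j
      fin_cases i <;> fin_cases j <;> simp [pauliZ, lowering]
  rcases lt_trichotomy p q with h | rfl | h
  · rw [key p q h, if_neg h.ne]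
  · rw [if_pos rfl, annih, tensorOp_conjTranspose, tensorOp_mul, tensorOp_mul, ← tensorOp_one]
    refine tensorOp_add_at p _ _ _ ?_ ?_
    · intro r hr
      rcases lt_or_gt_of_ne hr with h | h
      · simp [h, pauliZ_conj, pauliZ_sq]
      · simp [h.not_gt, hr]
    · simp only [lt_irrefl, if_false, if_true, lowering_conj]
      ext i j
      fin_cases i <;> fin_cases j <;> simp [lowering]
  · have := congrArg Matrix.conjTranspose (key q p h)
    simp only [Matrix.conjTranspose_add, Matrix.conjTranspose_mul,
      Matrix.conjTranspose_conjTranspose, Matrix.conjTranspose_zero] at this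
    rw [if_neg h.ne', this]

theorem gam_isHermitian {n : ℕ} (m : Fin (2 * n)) : (gam m).conjTranspose = gam m := by
  unfold gam
  split_ifs
  · simp [add_comm]
  · simp [Matrix.conjTranspose_smul, add_comm, sub_eq_add_neg]

/-- The canonical anticommutation relations of the Majorana operators. -/
theorem gam_anticomm {n : ℕ} (m l : Fin (2 * n)) :
    gam m * gam l + gam l * gam m = if m = l then 2 else 0 := by
  have h1 := annih_anticomm (mode m) (mode l)
  have h2 := annih_conj_anticomm (mode m) (mode l)
  have h3 := annih_conj_anticomm (mode l) (mode m)
  have h4 := congrArg Matrix.conjTranspose h1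
  simp only [Matrix.conjTranspose_add, Matrix.conjTranspose_mul,
    Matrix.conjTranspose_zero] at h4
  have hm : m = l ↔ mode m = mode l ∧ m.val % 2 = l.val % 2 := by
    simp only [mode, Fin.ext_iff]; omega
  simp only [eq_comm (a := mode l)] at h3
  set a := annih (mode m)
  set b := annih (mode l)
  set a' := a.conjTranspose
  set b' := b.conjTranspose
  have hI : ∀ X Y : Op n, (-Complex.I) • X * (-Complex.I) • Y = -(X * Y) := by
    intro X Y
    simp [smul_smul]
  have e1 : (a + a') * (b + b') + (b + b') * (a + a')
      = (a * b + b * a) + (a * b' + b' * a) + (b * a' + a' * b) + (b' * a' + a' * b') := by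
    noncomm_ring
  have e2 : (a - a') * (b - b') + (b - b') * (a - a')
      = (a * b + b * a) - (a * b' + b' * a) - (b * a' + a' * b) + (b' * a' + a' * b') := by
    noncomm_ring
  have e3 : (a + a') * (b - b') + (b - b') * (a + a')
      = (a * b + b * a) - (a * b' + b' * a) + (b * a' + a' * b) - (b' * a' + a' * b') := by
    noncomm_ring
  have e4 : (a - a') * (b + b') + (b + b') * (a - a')
      = (a * b + b * a) + (a * b' + b' * a) - (b * a' + a' * b) - (b' * a' + a' * b') := by
    noncomm_ring
  rw [h1, h2, h3, h4] at e1 e2 e3 e4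
  have hmm := Nat.mod_two_eq_zero_or_one m.val
  have hll := Nat.mod_two_eq_zero_or_one l.val
  unfold gam
  rcases hmm with hm0 | hm0 <;> rcases hll with hl0 | hl0 <;>
    simp only [hm, hm0, hl0, if_true, one_ne_zero, zero_ne_one, if_false, and_true, and_false, hI]
  · rw [e1]; split_ifs <;> norm_num
  · rw [mul_smul_comm, smul_mul_assoc, ← smul_add, e3]; simp
  · rw [mul_smul_comm, smul_mul_assoc, ← smul_add, e4]; simp
  · rw [← neg_add, e2]; split_ifs <;> norm_num

/-- `γ(v) = ∑_m v_m γ_m`. -/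
def gamVec {n : ℕ} (v : EuclideanSpace ℝ (Fin (2 * n))) : Op n := ∑ m, (v m : ℂ) • gam m

theorem gamVec_conjTranspose {n : ℕ} (v : EuclideanSpace ℝ (Fin (2 * n))) :
    (gamVec v).conjTranspose = gamVec v := by
  simp [gamVec, Matrix.conjTranspose_sum, Matrix.conjTranspose_smul, gam_isHermitian]

theorem gamVec_anticomm {n : ℕ} (v w : EuclideanSpace ℝ (Fin (2 * n))) :
    gamVec v * gamVec w + gamVec w * gamVec v = ((2 * inner ℝ v w : ℝ) : ℂ) • (1 : Op n) := by
  have : gamVec v * gamVec w + gamVec w * gamVec v =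
      ∑ m, ∑ l, ((v m : ℂ) * (w l : ℂ)) • (gam m * gam l + gam l * gam m) := by
    simp only [gamVec, Finset.sum_mul_sum, smul_add, Finset.sum_add_distrib, smul_mul_smul_comm]
    congr 1
    rw [Finset.sum_comm]
    simp only [mul_comm]
  rw [this]
  simp only [gam_anticomm, smul_ite, smul_zero, Finset.sum_ite_eq, Finset.mem_univ, if_true]
  have h2 : (2 : Op n) = (2 : ℂ) • (1 : Op n) := by simp [two_smul, one_add_one_eq_two]
  simp only [h2, smul_smul, ← Finset.sum_smul]
  congr 1
  simp only [PiLp.inner_apply, RCLike.inner_apply, conj_trivial]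
  push_cast
  rw [Finset.mul_sum]
  exact Finset.sum_congr rfl fun m _ => by ring

/-- The fermion parity operator `Z ⊗ ⋯ ⊗ Z`. -/
def parity (n : ℕ) : Op n := tensorOp fun _ => pauliZ

theorem parity_sq (n : ℕ) : parity n * parity n = 1 := by
  rw [parity, tensorOp_mul, ← tensorOp_one]
  simp [pauliZ_sq]

theorem parity_conj (n : ℕ) : (parity n).conjTranspose = parity n := by
  rw [parity, tensorOp_conjTranspose]
  simp [pauliZ_conj]

theorem parity_annih {n : ℕ} (p : Fin n) : annih p * parity n + parity n * annih p = 0 := by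
  refine tensorOp_anticomm p _ _ ?_ ?_
  · intro r hr
    by_cases h : r < p <;> simp [h, hr]
  · simp only [lt_irrefl, if_false, if_true]
    ext i j
    fin_cases i <;> fin_cases j <;> simp [pauliZ, lowering]

theorem parity_gam {n : ℕ} (m : Fin (2 * n)) : gam m * parity n + parity n * gam m = 0 := by
  have h1 := parity_annih (mode m)
  have h2 := congrArg Matrix.conjTranspose h1
  simp only [Matrix.conjTranspose_add, Matrix.conjTranspose_mul, parity_conj,
    Matrix.conjTranspose_zero] at h2
  unfold gam
  split_ifs
  · calc _ = (annih (mode m) * parity n + parity n * annih (mode m)) +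
        (parity n * (annih (mode m)).conjTranspose + (annih (mode m)).conjTranspose * parity n) := by
          noncomm_ring
      _ = 0 := by rw [h1, h2, add_zero]
  · rw [smul_mul_assoc, mul_smul_comm, ← smul_add]
    calc _ = (-Complex.I) • ((annih (mode m) * parity n + parity n * annih (mode m)) -
        (parity n * (annih (mode m)).conjTranspose +
          (annih (mode m)).conjTranspose * parity n)) := by
          congr 1; noncomm_ring
      _ = 0 := by rw [h1, h2]; simp

theorem parity_gamVec {n : ℕ} (v : EuclideanSpace ℝ (Fin (2 * n))) :
    parity n * gamVec v = -(gamVec v * parity n) := by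
  have h : ∀ m, parity n * gam m = -(gam m * parity n) := fun m =>
    eq_neg_of_add_eq_zero_right (parity_gam m)
  simp [gamVec, Finset.mul_sum, Finset.sum_mul, h]

theorem gamVec_sub_smul {n : ℕ} (v w : EuclideanSpace ℝ (Fin (2 * n))) (c : ℝ) :
    gamVec (v - c • w) = gamVec v - (c : ℂ) • gamVec w := by
  simp only [gamVec, PiLp.sub_apply, PiLp.smul_apply, smul_eq_mul, Complex.ofReal_sub,
    Complex.ofReal_mul, sub_smul, Finset.sum_sub_distrib, Finset.smul_sum, smul_smul]

theorem exists_unitary_reflection {n : ℕ} (w : EuclideanSpace ℝ (Fin (2 * n))) :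
    ∃ U ∈ Matrix.unitaryGroup (Bits n) ℂ,
      ∀ v, U * gamVec v * U.conjTranspose = gamVec ((ℝ ∙ w)ᗮ.reflection v) := by
  by_cases hw : w = 0
  · subst hw
    refine ⟨1, one_mem _, fun v => ?_⟩
    rw [Submodule.reflection_orthogonal_apply, Submodule.reflection_singleton_apply]
    simp
  · have hn : ‖w‖ ≠ 0 := norm_ne_zero_iff.2 hw
    set e := ‖w‖⁻¹ • w with he
    have hee : inner ℝ e e = (1 : ℝ) := by
      rw [he, real_inner_smul_left, real_inner_smul_right, real_inner_self_eq_norm_sq]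
      field_simp
    have h1 : gamVec e * gamVec e = 1 := by
      have h := gamVec_anticomm e e
      rw [hee, ← two_smul ℂ] at h
      exact smul_right_injective _ (two_ne_zero' ℂ) (by simpa using h)
    refine ⟨gamVec e * parity n, ?_, fun v => ?_⟩
    · rw [Matrix.mem_unitaryGroup_iff, Matrix.star_eq_conjTranspose, Matrix.conjTranspose_mul,
        gamVec_conjTranspose, parity_conj, Matrix.mul_assoc, ← Matrix.mul_assoc (parity n),
        parity_sq, Matrix.one_mul, h1]
    · have h2 : gamVec e * gamVec v = ((2 * inner ℝ e v : ℝ) : ℂ) • (1 : Op n)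
          - gamVec v * gamVec e := eq_sub_of_add_eq (gamVec_anticomm e v)
      have h3 : (ℝ ∙ w)ᗮ.reflection v = v - (2 * inner ℝ e v) • e := by
        rw [Submodule.reflection_orthogonal_apply, Submodule.reflection_singleton_apply, he,
          real_inner_smul_left, smul_smul, neg_sub, ← Nat.cast_smul_eq_nsmul ℝ, smul_smul]
        congr 2
        simp only [RCLike.ofReal_real_eq_id, id, Nat.cast_ofNat]
        field_simp
      calc gamVec e * parity n * gamVec v * (gamVec e * parity n).conjTranspose
          = gamVec e * (parity n * gamVec v * parity n) * gamVec e := by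
            rw [Matrix.conjTranspose_mul, gamVec_conjTranspose, parity_conj]
            noncomm_ring
        _ = -(gamVec e * gamVec v * gamVec e) := by
            rw [parity_gamVec, Matrix.neg_mul, Matrix.mul_assoc (gamVec v), parity_sq]
            noncomm_ring
        _ = gamVec v - ((2 * inner ℝ e v : ℝ) : ℂ) • gamVec e := by
            rw [h2, Matrix.sub_mul, Matrix.mul_assoc, h1]
            simp
        _ = _ := by rw [h3, gamVec_sub_smul]

theorem exists_unitary_of_isometry {n : ℕ}
    (φ : EuclideanSpace ℝ (Fin (2 * n)) ≃ₗᵢ[ℝ] EuclideanSpace ℝ (Fin (2 * n))) :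
    ∃ U ∈ Matrix.unitaryGroup (Bits n) ℂ,
      ∀ v, U * gamVec v * U.conjTranspose = gamVec (φ v) := by
  obtain ⟨l, -, rfl⟩ := φ.reflections_generate_dim
  induction l with
  | nil => exact ⟨1, one_mem _, by simp⟩
  | cons w l ih =>
    obtain ⟨U, hU, hU'⟩ := exists_unitary_reflection w
    obtain ⟨V, hV, hV'⟩ := ih
    refine ⟨U * V, mul_mem hU hV, fun v => ?_⟩
    rw [List.map_cons, List.prod_cons, LinearIsometryEquiv.coe_mul, Function.comp_apply, ← hU',
      ← hV', Matrix.conjTranspose_mul]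
    simp only [Matrix.mul_assoc]

/-- Every `Q ∈ O(2n)` is implemented by a unitary. -/
theorem exists_implements {n : ℕ} (Q : Orth n) : ∃ U : Op n, Implements U Q.1 := by
  have hQ : Q.1.transpose * Q.1 = 1 := (Matrix.mem_orthogonalGroup_iff' _ _).1 Q.2
  let f : EuclideanSpace ℝ (Fin (2 * n)) →ₗ[ℝ] EuclideanSpace ℝ (Fin (2 * n)) :=
    Matrix.toEuclideanLin Q.1
  have hf : ∀ v, ‖f v‖ = ‖v‖ := by
    intro v
    have : inner ℝ (f v) (f v) = inner ℝ v v := by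
      simp only [f, EuclideanSpace.inner_eq_star_dotProduct, Matrix.ofLp_toLpLin, Matrix.toLin'_apply,
        star_trivial]
      rw [Matrix.dotProduct_mulVec, Matrix.vecMul_mulVec, hQ, Matrix.vecMul_one]
    rw [real_inner_self_eq_norm_sq, real_inner_self_eq_norm_sq] at this
    exact (sq_eq_sq₀ (norm_nonneg _) (norm_nonneg _)).1 this
  let φ := LinearIsometry.toLinearIsometryEquiv (⟨f, hf⟩ : _ →ₗᵢ[ℝ] _) rfl
  obtain ⟨U, hU, hU'⟩ := exists_unitary_of_isometry φ
  refine ⟨U, hU, fun m => ?_⟩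
  have h1 : gamVec (EuclideanSpace.single m (1 : ℝ)) = gam m := by
    simp [gamVec]
  have h2 : ∀ l, φ (EuclideanSpace.single m (1 : ℝ)) l = Q.1 l m := by
    intro l
    simp [φ, f]
  rw [← h1, hU']
  simp [gamVec, h2]

/-- The fermionic Gaussian (generalized matchgate) unitary `U_Q`, `Q ∈ O(2n)`, with some choice of
the physically irrelevant phase. -/
def gaussianUnitary {n : ℕ} (Q : Orth n) : Op n := (exists_implements Q).choose

/-! ### The experiment and the estimators -/

/-- Signed permutation matrices, the elements of `B(2n)`. -/
def IsSignedPerm {n : ℕ} (Q : Orth n) : Prop :=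
  ∃ (π : Equiv.Perm (Fin (2 * n))) (s : Fin (2 * n) → ℤˣ),
    ∀ l m, Q.1 l m = if l = π m then (((s m : ℤˣ) : ℤ) : ℝ) else 0

/-- The probability `⟨b| E(U_Q ρ U_Q†) |b⟩` of the outcome `b` in the noisy experiment. -/
def outcomeProb {n : ℕ} (ρ : Op n) (E : Op n →ₗ[ℂ] Op n) (Q : Orth n) (b : Bits n) : ℝ :=
  (E (gaussianUnitary Q * ρ * (gaussianUnitary Q).conjTranspose) b b).re

/-- The law of one experiment `(Q, b)`: `Q` has law `μ` on the ensemble `G`, and `b` is drawn from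
the conditional distribution `outcomeProb ρ E Q`. -/
def shotLaw {n : ℕ} {G : Subgroup (Orth n)} [MeasurableSpace G] (μ : Measure G) (ρ : Op n)
    (E : Op n →ₗ[ℂ] Op n) : Measure (G × Bits n) :=
  (μ.prod Measure.count).withDensity fun x => ENNReal.ofReal (outcomeProb ρ E x.1.1 x.2)

/-- One classical shadow `M⁻¹(U_Q† |b⟩⟨b| U_Q)`. -/
def snapshot {n : ℕ} (Q : Orth n) (b : Bits n) : Op n :=
  shadowInverse n
    ((gaussianUnitary Q).conjTranspose * Matrix.single b b 1 * gaussianUnitary Q)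

/-- The empirical mean `ρ̂(T)` of the `T` classical shadows of the record `ω`. -/
def shadowMean {n T : ℕ} {G : Subgroup (Orth n)} (ω : Fin T → G × Bits n) : Op n :=
  (T : ℂ)⁻¹ • ∑ t, snapshot (ω t).1.1 (ω t).2

/-- `S₂ = Π₂(N)`. -/
def sym2 (n : ℕ) : Op n := irrepProj n 2 (numberOp n)

/-- `S₄ = Π₄(N²)`. -/
def sym4 (n : ℕ) : Op n := irrepProj n 4 (numberOp n ^ 2)

/-- The ideal value of `S₂` in the `η`-particle sector. -/
def idealSym2 (n η : ℕ) : ℝ := η - n / 2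

/-- The ideal value of `S₄` in the `η`-particle sector. -/
def idealSym4 (n η : ℕ) : ℝ := (n.choose 2 : ℝ) / 2 - η * (n - η)

/-- The symmetry-adjusted estimate `tr(O σ) / (tr(S σ) / s)` of an observable `O`, computed from
the empirical shadow `σ`, a symmetry operator `S` and its ideal value `s`. -/
def adjustedEstimate {n : ℕ} (S : Op n) (s : ℝ) (O σ : Op n) : ℂ :=
  (O * σ).trace / ((S * σ).trace / s)

end

end FermionShadow

open FermionShadow

namespace FermionShadow

noncomputable section

/-! ### Algebra of the Majorana operators -/

/-! Conjugation by `U_Q` preserves the Majorana degree, so it acts on the `Γ_s` by real matrices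
`R(Q)` (`rotCoeff`), block diagonal in `|s|`. The sign flips in `B(2n)` annihilate every Haar moment
of these matrix elements in which some index occurs an odd number of times, and the permutations
make the surviving second moments depend on the degree only (`integral_rotCoeff_mul`). Hence the
single-shot estimate of `Γ_s` has mean exactly `F_λ tr(Γ_s ρ)`, where `λ = |s|` and `F_λ` is the
noise ratio of that degree (`integral_shotEstimate`). Noise therefore only rescales each degree by
an unknown factor.

In the second moment the flips remove every component of `ρ` except the identity, and trace
preservation removes `E`. It equals `1/f_λ = binom(2n,λ)/|D_λ|`, with `D_λ` the set of diagonal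
Majorana operators of degree `λ` (`integral_shotEstimate_sq`). For `λ = 2, 4` this is at most `2n²`,
and the same number bounds the estimate itself. Bernstein's inequality and a union bound over
`O(n⁴)` operators give accuracy `a` for all of them once `T a²` is of order `n² log(n/δ)`
(`ofReal_le_measure_meanEstimate`).

The operators `S₂` and `S₄` are multiples of sums of Majorana operators of one degree, so `tr(S
ρ̂)/s` estimates the same `F_λ`, with error at most `κ a`. Here `κ` depends on `c` only: for `S₂` by
`|s₂| ≥ cn`, and for `S₄` because `s₄ = s₂² - n/4` has size of order `n²` unless `n` is bounded,
while `4 s₄` is a nonzero integer (`sq_div_abs_idealSym4_le`). In the quotient `F_λ` cancels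
(`abs_div_sub_le`). With `a` proportional to `ε F` the error is at most `ε`, so `K = 0` works. -/

theorem conj_mul_conj {n : ℕ} {U : Op n} (hU : U ∈ Matrix.unitaryGroup (Bits n) ℂ) (X Y : Op n) :
    (U * X * U.conjTranspose) * (U * Y * U.conjTranspose) = U * (X * Y) * U.conjTranspose := by
  have h : U.conjTranspose * U = 1 := Matrix.mem_unitaryGroup_iff'.1 hU
  calc _ = U * X * (U.conjTranspose * U) * Y * U.conjTranspose := by noncomm_ring
    _ = _ := by rw [h]; noncomm_ring

theorem conj_list_prod {n : ℕ} {U : Op n} (hU : U ∈ Matrix.unitaryGroup (Bits n) ℂ)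
    (l : List (Op n)) :
    U * l.prod * U.conjTranspose = (l.map fun X => U * X * U.conjTranspose).prod := by
  induction l with
  | nil =>
    rw [List.prod_nil, mul_one]
    exact Matrix.mem_unitaryGroup_iff.1 hU
  | cons X l ih => rw [List.prod_cons, List.map_cons, List.prod_cons, ← ih, conj_mul_conj hU]

theorem gam_mul_self {n : ℕ} (m : Fin (2 * n)) : gam m * gam m = 1 := by
  have h := gam_anticomm m m
  rw [if_pos rfl, ← two_smul ℂ] at h
  refine smul_right_injective _ (two_ne_zero' ℂ) ?_
  simp only [h, two_smul, one_add_one_eq_two]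

theorem gam_mul_gam_of_ne {n : ℕ} {m l : Fin (2 * n)} (h : m ≠ l) :
    gam m * gam l = -(gam l * gam m) := by
  have := gam_anticomm m l
  rw [if_neg h] at this
  exact eq_neg_of_add_eq_zero_left this

theorem gam_mem_unitaryGroup {n : ℕ} (m : Fin (2 * n)) :
    gam m ∈ Matrix.unitaryGroup (Bits n) ℂ := by
  rw [Matrix.mem_unitaryGroup_iff, Matrix.star_eq_conjTranspose, gam_isHermitian, gam_mul_self]

/-- Each factor passed costs a sign, except the factor equal to `γ_m` itself, which commutes. -/
theorem gam_mul_prod {n : ℕ} (m : Fin (2 * n)) (l : List (Fin (2 * n))) (hl : l.Nodup) :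
    gam m * (l.map gam).prod =
      ((-1 : ℂ) ^ l.length * if m ∈ l then -1 else 1) • ((l.map gam).prod * gam m) := by
  induction l with
  | nil => simp
  | cons a l ih =>
    have ih := ih (List.nodup_cons.1 hl).2
    have ha := (List.nodup_cons.1 hl).1
    rw [List.map_cons, List.prod_cons, List.length_cons, pow_succ]
    by_cases h : m = a
    · subst h
      have ih' : (gam m * (l.map gam).prod) = ((-1 : ℂ) ^ l.length) • ((l.map gam).prod * gam m) := by
        simpa [ha] using ih
      rw [mul_assoc (gam m) _ (gam m)]
      nth_rewrite 1 [ih']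
      simp
    · rw [← mul_assoc, gam_mul_gam_of_ne h, neg_mul, mul_assoc, ih]
      by_cases hm : m ∈ l <;> simp [h, hm, mul_assoc]

theorem prod_gam_reverse {n : ℕ} (l : List (Fin (2 * n))) (hl : l.Nodup) :
    (l.reverse.map gam).prod = ((-1 : ℂ) ^ (l.length.choose 2)) • (l.map gam).prod := by
  induction l with
  | nil => simp
  | cons a l ih =>
    have ih := ih (List.nodup_cons.1 hl).2
    have ha := (List.nodup_cons.1 hl).1
    have h := gam_mul_prod a l (List.nodup_cons.1 hl).2
    rw [if_neg ha, mul_one] at h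
    rw [List.reverse_cons, List.map_append, List.prod_append, ih, List.map_cons (l := l),
      List.prod_cons (l := l.map gam), h, List.length_cons, Nat.choose_succ_succ' _ 1, Nat.choose_one_right, pow_add, smul_smul,
      mul_right_comm, ← mul_pow]
    simp

/-- Only `ε² = 1` is recorded: the sign of the permutation always enters squared later on. -/
theorem prod_gam_perm {n : ℕ} {l l' : List (Fin (2 * n))} (h : l.Perm l') (hl : l.Nodup) :
    ∃ ε : ℂ, ε * ε = 1 ∧ (l.map gam).prod = ε • (l'.map gam).prod := by
  induction h with
  | nil => exact ⟨1, by simp⟩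
  | cons a _ ih =>
    obtain ⟨ε, h1, h2⟩ := ih (List.nodup_cons.1 hl).2
    exact ⟨ε, h1, by simp [h2]⟩
  | swap a b l =>
    refine ⟨-1, by simp, ?_⟩
    have hab : b ≠ a := by
      simp only [List.nodup_cons, List.mem_cons, not_or] at hl
      exact hl.1.1
    simp only [List.map_cons, List.prod_cons]
    rw [← mul_assoc, gam_mul_gam_of_ne hab]
    simp [mul_assoc]
  | trans h1 _ ih1 ih2 =>
    obtain ⟨ε, h3, h4⟩ := ih1 hl
    obtain ⟨ε', h5, h6⟩ := ih2 (h1.nodup_iff.1 hl)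
    exact ⟨ε * ε', by rw [mul_mul_mul_comm, h3, h5, one_mul], by rw [h4, h6, smul_smul]⟩

theorem majorana_empty {n : ℕ} : majorana (∅ : Finset (Fin (2 * n))) = 1 := by
  simp [majorana]

/-- Reversing the product gives `(-1)^binom(|s|,2)`, which turns the conjugated phase
`i^binom(|s|,2)` back into `(-i)^binom(|s|,2)`. -/
theorem majorana_conjTranspose {n : ℕ} (s : Finset (Fin (2 * n))) :
    (majorana s).conjTranspose = majorana s := by
  have h : ∀ l : List (Fin (2 * n)),
      (l.map gam).prod.conjTranspose = (l.reverse.map gam).prod := by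
    intro l
    rw [Matrix.conjTranspose_list_prod]
    simp [List.map_map, Function.comp_def, gam_isHermitian, List.map_reverse]
  rw [majorana, Matrix.conjTranspose_smul, h, prod_gam_reverse _ (s.sort_nodup _), smul_smul,
    Finset.length_sort]
  congr 1
  simp [← mul_pow]

theorem majorana_mem_unitaryGroup {n : ℕ} (s : Finset (Fin (2 * n))) :
    majorana s ∈ Matrix.unitaryGroup (Bits n) ℂ := by
  have h : (s.sort.map gam).prod ∈ Matrix.unitaryGroup (Bits n) ℂ :=
    Submonoid.list_prod_mem _ (by simpa using fun a _ => gam_mem_unitaryGroup a)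
  have h' := Matrix.mem_unitaryGroup_iff.1 h
  rw [Matrix.mem_unitaryGroup_iff, majorana, star_smul, smul_mul_smul_comm, h']
  simp [← mul_pow]

theorem majorana_mul_self {n : ℕ} (s : Finset (Fin (2 * n))) : majorana s * majorana s = 1 := by
  have h := Matrix.mem_unitaryGroup_iff.1 (majorana_mem_unitaryGroup s)
  rwa [Matrix.star_eq_conjTranspose, majorana_conjTranspose] at h

theorem gam_mul_majorana_mul_gam {n : ℕ} (m : Fin (2 * n)) (s : Finset (Fin (2 * n))) :
    gam m * majorana s * gam m = ((-1 : ℂ) ^ s.card * if m ∈ s then -1 else 1) • majorana s := by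
  rw [majorana, mul_smul_comm, gam_mul_prod _ _ (s.sort_nodup _), smul_mul_assoc, smul_mul_assoc,
    mul_assoc, gam_mul_self, mul_one, smul_smul, smul_smul, mul_comm]
  simp

/-! ### Conjugation by Gaussian unitaries, sign flips and permutations. -/

theorem gaussianUnitary_mem {n : ℕ} (Q : Orth n) :
    gaussianUnitary Q ∈ Matrix.unitaryGroup (Bits n) ℂ := (exists_implements Q).choose_spec.1

/-- Conjugation by the Gaussian unitary `U_Q`. -/
def rotate {n : ℕ} (Q : Orth n) : Op n →ₗ[ℂ] Op n :=
  (LinearMap.mulRight ℂ (gaussianUnitary Q).conjTranspose).comp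
    (LinearMap.mulLeft ℂ (gaussianUnitary Q))

theorem rotate_apply {n : ℕ} (Q : Orth n) (X : Op n) :
    rotate Q X = gaussianUnitary Q * X * (gaussianUnitary Q).conjTranspose := rfl

theorem rotate_gam {n : ℕ} (Q : Orth n) (m : Fin (2 * n)) :
    rotate Q (gam m) = ∑ l, (Q.1 l m : ℂ) • gam l := (exists_implements Q).choose_spec.2 m

theorem rotate_mul {n : ℕ} (Q : Orth n) (X Y : Op n) :
    rotate Q (X * Y) = rotate Q X * rotate Q Y := (conj_mul_conj (gaussianUnitary_mem Q) X Y).symm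

theorem rotate_one {n : ℕ} (Q : Orth n) : rotate Q 1 = 1 := by
  rw [rotate_apply, mul_one]
  exact Matrix.mem_unitaryGroup_iff.1 (gaussianUnitary_mem Q)

theorem rotate_conjTranspose {n : ℕ} (Q : Orth n) (X : Op n) :
    (rotate Q X).conjTranspose = rotate Q X.conjTranspose := by
  simp [rotate_apply, Matrix.conjTranspose_mul, mul_assoc]

theorem rotate_majorana {n : ℕ} (Q : Orth n) (s : Finset (Fin (2 * n))) :
    rotate Q (majorana s) =
      ((-Complex.I) ^ (s.card.choose 2)) • (s.sort.map fun m => rotate Q (gam m)).prod := by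
  rw [majorana, map_smul, rotate_apply, conj_list_prod (gaussianUnitary_mem Q), List.map_map]
  rfl

theorem trace_rotate {n : ℕ} (Q : Orth n) (X : Op n) : (rotate Q X).trace = X.trace := by
  have h : (gaussianUnitary Q).conjTranspose * gaussianUnitary Q = 1 :=
    Matrix.mem_unitaryGroup_iff'.1 (gaussianUnitary_mem Q)
  rw [rotate_apply, Matrix.trace_mul_comm, ← mul_assoc, h, one_mul]

theorem trace_rotate_mul_rotate {n : ℕ} (Q : Orth n) (X Y : Op n) :
    (rotate Q X * rotate Q Y).trace = (X * Y).trace := by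
  rw [← rotate_mul, trace_rotate]

/-- The signed permutation `e_m ↦ σ_m e_{π m}`. -/
def signedPerm {n : ℕ} (π : Equiv.Perm (Fin (2 * n))) (σ : Fin (2 * n) → ℤˣ) : Orth n :=
  ⟨Matrix.of fun l m => if l = π m then (((σ m : ℤˣ) : ℤ) : ℝ) else 0, by
    rw [Matrix.mem_orthogonalGroup_iff']
    ext i j
    simp only [Matrix.mul_apply, Matrix.transpose_apply, Matrix.of_apply,
      Matrix.one_apply, ite_mul, zero_mul, Finset.sum_ite_eq', Finset.mem_univ,
      if_true, EmbeddingLike.apply_eq_iff_eq]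
    split_ifs with h
    · subst h
      norm_cast
      simp
    · simp⟩

theorem isSignedPerm_signedPerm {n : ℕ} (π : Equiv.Perm (Fin (2 * n))) (σ : Fin (2 * n) → ℤˣ) :
    IsSignedPerm (signedPerm π σ) := ⟨π, σ, fun _ _ => rfl⟩

theorem rotate_signedPerm_gam {n : ℕ} (π : Equiv.Perm (Fin (2 * n))) (σ : Fin (2 * n) → ℤˣ)
    (m : Fin (2 * n)) : rotate (signedPerm π σ) (gam m) = (((σ m : ℤ)) : ℂ) • gam (π m) := by
  rw [rotate_gam]
  simp [signedPerm, ite_smul, apply_ite]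

/-- The reflection flipping the sign of `γ_m`. -/
def flip {n : ℕ} (m : Fin (2 * n)) : Orth n := signedPerm 1 fun k => if k = m then -1 else 1

theorem rotate_flip_majorana {n : ℕ} (m : Fin (2 * n)) (s : Finset (Fin (2 * n))) :
    rotate (flip m) (majorana s) = (if m ∈ s then -1 else 1 : ℂ) • majorana s := by
  have h : ∀ l : List (Fin (2 * n)), (l.map fun k => rotate (flip m) (gam k)).prod =
      (l.map fun k => if k = m then (-1 : ℂ) else 1).prod • (l.map gam).prod := by
    intro l
    induction l with
    | nil => simp
    | cons a l ih =>
      rw [List.map_cons, List.prod_cons, ih, flip, rotate_signedPerm_gam, smul_mul_smul_comm,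
        List.map_cons, List.prod_cons, List.map_cons, List.prod_cons]
      congr 2
      split_ifs <;> simp
  rw [rotate_majorana, h, smul_comm, ← List.prod_toFinset _ (s.sort_nodup _),
    Finset.sort_toFinset, Finset.prod_ite_eq', majorana]

theorem exists_rotate_perm_majorana {n : ℕ} (π : Equiv.Perm (Fin (2 * n)))
    (s : Finset (Fin (2 * n))) :
    ∃ ε : ℂ, ε * ε = 1 ∧ rotate (signedPerm π 1) (majorana s) =
      ε • majorana (s.map π.toEmbedding) := by
  have hp : (s.sort.map π).Perm (s.map π.toEmbedding).sort := by
    refine (List.perm_ext_iff_of_nodup ((s.sort_nodup _).map π.injective)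
      (Finset.sort_nodup _ _)).2 fun a => ?_
    rw [List.mem_map, Finset.mem_sort, Finset.mem_map]
    simp
  obtain ⟨ε, h1, h2⟩ := prod_gam_perm hp ((s.sort_nodup _).map π.injective)
  refine ⟨ε, h1, ?_⟩
  rw [rotate_majorana, majorana, Finset.card_map, smul_comm ε, ← h2, List.map_map]
  congr 3
  funext m
  simp [rotate_signedPerm_gam]

/-- If some `m` lies in exactly one of `s`, `t`, the flip of `γ_m` negates the product while
conjugation preserves its trace. -/
theorem trace_majorana_mul {n : ℕ} (s t : Finset (Fin (2 * n))) :
    (majorana s * majorana t).trace = if s = t then (2 : ℂ) ^ n else 0 := by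
  split_ifs with h
  · subst h
    rw [majorana_mul_self, Matrix.trace_one]
    simp
  · obtain ⟨m, hm⟩ : ∃ m, ¬(m ∈ s ↔ m ∈ t) := by
      by_contra! h'
      exact h (Finset.ext h')
    have h1 := trace_rotate_mul_rotate (flip m) (majorana s) (majorana t)
    rw [rotate_flip_majorana, rotate_flip_majorana, smul_mul_smul_comm, Matrix.trace_smul] at h1
    have h2 : ((if m ∈ s then -1 else 1 : ℂ) * if m ∈ t then -1 else 1) = -1 := by
      by_cases h3 : m ∈ s <;> by_cases h4 : m ∈ t <;> simp_all
    rw [h2, neg_one_smul] at h1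
    exact self_eq_neg.1 h1.symm

theorem linearIndependent_majorana (n : ℕ) :
    LinearIndependent ℂ (majorana : Finset (Fin (2 * n)) → Op n) := by
  rw [Fintype.linearIndependent_iff]
  intro g hg t
  have h := congrArg (fun X => (majorana t * X).trace) hg
  simpa [Finset.mul_sum, Matrix.trace_sum, trace_majorana_mul] using h

/-- There are `2^{2n} = dim` linearly independent `Γ_s`, so they form a basis; orthogonality
identifies the coefficients. -/
theorem majorana_expansion {n : ℕ} (X : Op n) :
    X = ∑ s, (((2 : ℂ) ^ n)⁻¹ * (majorana s * X).trace) • majorana s := by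
  have hc : Fintype.card (Finset (Fin (2 * n))) = Module.finrank ℂ (Op n) := by
    simp [Module.finrank_matrix, pow_mul, ← mul_pow]
  let b := basisOfLinearIndependentOfCardEqFinrank (linearIndependent_majorana n) hc
  have hb : ∀ s, b s = majorana s := fun s => by simp [b]
  have hX : X = ∑ s, b.repr X s • majorana s := by
    conv_lhs => rw [← b.sum_repr X]
    simp [hb]
  have h : ∀ s, (majorana s * X).trace = b.repr X s * 2 ^ n := by
    intro s
    conv_lhs => rw [hX]
    simp [Finset.mul_sum, Matrix.trace_sum, trace_majorana_mul]
  conv_lhs => rw [hX]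
  refine Finset.sum_congr rfl fun s _ => ?_
  rw [h]
  congr 1
  field_simp

/-- Parseval's identity. -/
theorem trace_mul_eq_sum {n : ℕ} (X Y : Op n) :
    (X * Y).trace = ((2 : ℂ) ^ n)⁻¹ * ∑ s, (X * majorana s).trace * (majorana s * Y).trace := by
  conv_lhs => rw [majorana_expansion Y]
  simp only [Finset.mul_sum, Matrix.trace_sum, mul_smul_comm, Matrix.trace_smul, smul_eq_mul]
  exact Finset.sum_congr rfl fun s _ => by ring

theorem ext_majorana {n : ℕ} {f g : Op n →ₗ[ℂ] Op n} (h : ∀ s, f (majorana s) = g (majorana s)) :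
    f = g := by
  ext1 X
  rw [majorana_expansion X]
  simp [h]

/-- The chosen unitaries multiply only up to a phase, which conjugation does not see. It suffices to
compare both sides on the `γ_m`, since both are multiplicative. -/
theorem rotate_comp {n : ℕ} (Q R : Orth n) (X : Op n) :
    rotate (Q * R) X = rotate Q (rotate R X) := by
  have hg : ∀ m, rotate (Q * R) (gam m) = rotate Q (rotate R (gam m)) := by
    intro m
    simp only [rotate_gam, map_sum, map_smul, Finset.smul_sum, smul_smul]
    rw [Finset.sum_comm]
    refine Finset.sum_congr rfl fun l _ => ?_
    rw [← Finset.sum_smul]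
    congr 1
    simp [Matrix.mul_apply, mul_comm]
  have : rotate (Q * R) = (rotate Q).comp (rotate R) := by
    refine ext_majorana fun s => ?_
    rw [LinearMap.comp_apply, rotate_majorana, rotate_majorana, map_smul, rotate_apply (X := List.prod _),
      conj_list_prod (gaussianUnitary_mem Q), List.map_map]
    congr 3
    funext m
    exact hg m
  rw [this]; rfl

/-! ### Degree preservation -/

/-- The Casimir superoperator `X ↦ ∑_m γ_m X γ_m`. -/
def casimir {n : ℕ} (X : Op n) : Op n := ∑ m, gam m * X * gam m

theorem casimir_majorana {n : ℕ} (s : Finset (Fin (2 * n))) :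
    casimir (majorana s) = ((-1 : ℂ) ^ s.card * (2 * n - 2 * s.card)) • majorana s := by
  simp only [casimir, gam_mul_majorana_mul_gam, ← Finset.sum_smul, ← Finset.mul_sum]
  congr 2
  have : ∀ m, (if m ∈ s then (-1 : ℂ) else 1) = 1 - 2 * if m ∈ s then 1 else 0 := by
    intro m; split_ifs <;> norm_num
  simp only [this, Finset.sum_sub_distrib, ← Finset.mul_sum, Finset.sum_ite_mem, Finset.univ_inter]
  simp

/-- Rotating both outer factors `γ_m` produces `∑_m Q_{km} Q_{lm}`, which is `δ_{kl}` by
orthogonality. -/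
theorem casimir_rotate {n : ℕ} (Q : Orth n) (X : Op n) :
    casimir (rotate Q X) = rotate Q (casimir X) := by
  have hQ : Q.1 * Q.1.transpose = 1 := (Matrix.mem_orthogonalGroup_iff _ _).1 Q.2
  have hq : ∀ k l, ∑ m, (Q.1 k m : ℂ) * (Q.1 l m : ℂ) = if k = l then 1 else 0 := by
    intro k l
    have := congrFun (congrFun hQ k) l
    rw [Matrix.mul_apply, Matrix.one_apply] at this
    simp only [Matrix.transpose_apply] at this
    have h := congrArg (fun x : ℝ => (x : ℂ)) this
    push_cast at h
    rw [h]
    split_ifs <;> simp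
  have : rotate Q (casimir X) = ∑ k, ∑ l, (∑ m, (Q.1 k m : ℂ) * (Q.1 l m : ℂ)) •
      (gam k * rotate Q X * gam l) := by
    simp only [casimir, map_sum, rotate_mul, rotate_gam, Finset.sum_mul, Finset.mul_sum,
      Finset.sum_smul, smul_mul_assoc, mul_smul_comm, Finset.smul_sum, smul_smul]
    rw [Finset.sum_comm]
    conv_rhs => rw [Finset.sum_comm]
    refine Finset.sum_congr rfl fun l _ => ?_
    rw [Finset.sum_comm]
    refine Finset.sum_congr rfl fun k _ => Finset.sum_congr rfl fun m _ => ?_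
    rw [mul_comm]
  rw [this]
  simp [hq, casimir]

theorem trace_mul_casimir {n : ℕ} (X Y : Op n) :
    (X * casimir Y).trace = (casimir X * Y).trace := by
  simp only [casimir, Finset.mul_sum, Finset.sum_mul, Matrix.trace_sum]
  refine Finset.sum_congr rfl fun m _ => ?_
  rw [← mul_assoc, Matrix.trace_mul_comm]
  simp only [mul_assoc]

/-- For equal parity the claim is immediate; for opposite parity equality would force `j + k = 2n`,
but `j + k` is odd. -/
theorem casimir_eigenvalue_injective {n : ℕ} {j k : ℕ} (hj : j ≤ 2 * n) (hk : k ≤ 2 * n)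
    (h : (-1 : ℂ) ^ j * (2 * n - 2 * j) = (-1 : ℂ) ^ k * (2 * n - 2 * k)) : j = k := by
  have h' : (-1 : ℤ) ^ j * (2 * n - 2 * j) = (-1 : ℤ) ^ k * (2 * n - 2 * k) := by exact_mod_cast h
  rcases Nat.even_or_odd j with ej | ej <;> rcases Nat.even_or_odd k with ek | ek <;>
    rw [ej.neg_one_pow, ek.neg_one_pow] at h'
  · omega
  · obtain ⟨a, rfl⟩ := ej
    obtain ⟨b, rfl⟩ := ek
    omega
  · obtain ⟨a, rfl⟩ := ej
    obtain ⟨b, rfl⟩ := ek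
    omega
  · omega

/-! ### Matrix elements of the rotations -/

/-- The matrix element `2^{-n} tr(Γ_t U_Q Γ_s U_Q†)`. -/
def rotCoeff {n : ℕ} (Q : Orth n) (t s : Finset (Fin (2 * n))) : ℂ :=
  ((2 : ℂ) ^ n)⁻¹ * (majorana t * rotate Q (majorana s)).trace

theorem rotate_majorana_eq_sum {n : ℕ} (Q : Orth n) (s : Finset (Fin (2 * n))) :
    rotate Q (majorana s) = ∑ t, rotCoeff Q t s • majorana t :=
  majorana_expansion _

/-- The Casimir superoperator is symmetric for the trace form and commutes with rotations, so matrix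
elements between its distinct eigenvalues vanish. -/
theorem rotCoeff_eq_zero {n : ℕ} (Q : Orth n) {t s : Finset (Fin (2 * n))} (h : t.card ≠ s.card) :
    rotCoeff Q t s = 0 := by
  have h1 := trace_mul_casimir (majorana t) (rotate Q (majorana s))
  rw [casimir_rotate, casimir_majorana, casimir_majorana, map_smul, mul_smul_comm, smul_mul_assoc,
    Matrix.trace_smul, Matrix.trace_smul, smul_eq_mul, smul_eq_mul, ← sub_eq_zero, ← sub_mul] at h1
  rcases mul_eq_zero.1 h1 with h2 | h2
  · exact absurd (casimir_eigenvalue_injective (by simpa using s.card_le_univ)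
      (by simpa using t.card_le_univ) (sub_eq_zero.1 h2)).symm h
  · rw [rotCoeff, h2, mul_zero]

theorem rotCoeff_empty {n : ℕ} (Q : Orth n) (t : Finset (Fin (2 * n))) :
    rotCoeff Q t ∅ = if t = ∅ then 1 else 0 := by
  rw [rotCoeff, majorana_empty, rotate_one, ← majorana_empty, trace_majorana_mul]
  split_ifs <;> simp

theorem exists_rotate_eq {n : ℕ} (Q : Orth n) (X : Op n) : ∃ Y, rotate Q Y = X := by
  refine ⟨(gaussianUnitary Q).conjTranspose * X * gaussianUnitary Q, ?_⟩
  have h : gaussianUnitary Q * (gaussianUnitary Q).conjTranspose = 1 :=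
    Matrix.mem_unitaryGroup_iff.1 (gaussianUnitary_mem Q)
  rw [rotate_apply]
  calc _ = gaussianUnitary Q * (gaussianUnitary Q).conjTranspose * X *
        (gaussianUnitary Q * (gaussianUnitary Q).conjTranspose) := by noncomm_ring
    _ = X := by rw [h, one_mul, mul_one]

/-- Parseval for the preimage of `Γ_t` under the rotation, whose square also has trace `2^n`. Plain
squares suffice because the `Γ_s` are Hermitian. -/
theorem sum_rotCoeff_sq {n : ℕ} (Q : Orth n) (t : Finset (Fin (2 * n))) :
    ∑ s, rotCoeff Q t s * rotCoeff Q t s = 1 := by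
  obtain ⟨Y, hY⟩ := exists_rotate_eq Q (majorana t)
  have h1 : ∀ s, rotCoeff Q t s = ((2 : ℂ) ^ n)⁻¹ * (Y * majorana s).trace := fun s => by
    rw [rotCoeff, ← hY, trace_rotate_mul_rotate]
  have h2 := trace_mul_eq_sum Y Y
  have h3 : (Y * Y).trace = 2 ^ n := by
    rw [← trace_rotate_mul_rotate Q, hY, trace_majorana_mul, if_pos rfl]
  have h4 : ∀ s, (majorana s * Y).trace = (Y * majorana s).trace := fun s => Matrix.trace_mul_comm _ _
  simp only [h4] at h2
  simp only [h1, mul_mul_mul_comm _ (Matrix.trace _), ← Finset.mul_sum]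
  rw [mul_assoc, ← h2, h3]
  exact inv_mul_cancel₀ (by positivity)

theorem rotCoeff_mul_flip {n : ℕ} (Q : Orth n) (m : Fin (2 * n)) (t s : Finset (Fin (2 * n))) :
    rotCoeff (Q * flip m) t s = (if m ∈ s then -1 else 1) * rotCoeff Q t s := by
  rw [rotCoeff, rotate_comp, rotate_flip_majorana, map_smul, mul_smul_comm, Matrix.trace_smul,
    rotCoeff, smul_eq_mul]
  ring

theorem rotCoeff_flip_mul {n : ℕ} (Q : Orth n) (m : Fin (2 * n)) (t s : Finset (Fin (2 * n))) :
    rotCoeff (flip m * Q) t s = (if m ∈ t then -1 else 1) * rotCoeff Q t s := by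
  have h : majorana t = (if m ∈ t then -1 else 1 : ℂ) • rotate (flip m) (majorana t) := by
    rw [rotate_flip_majorana, smul_smul]
    split_ifs <;> simp
  rw [rotCoeff, rotate_comp, h, smul_mul_assoc, Matrix.trace_smul, trace_rotate_mul_rotate, rotCoeff,
    smul_eq_mul]
  ring

theorem exists_rotCoeff_mul_perm {n : ℕ} (π : Equiv.Perm (Fin (2 * n)))
    (s : Finset (Fin (2 * n))) : ∃ ε : ℂ, ε * ε = 1 ∧ ∀ (Q : Orth n) t,
      rotCoeff (Q * signedPerm π 1) t s = ε * rotCoeff Q t (s.map π.toEmbedding) := by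
  obtain ⟨ε, h1, h2⟩ := exists_rotate_perm_majorana π s
  refine ⟨ε, h1, fun Q t => ?_⟩
  rw [rotCoeff, rotate_comp, h2, map_smul, mul_smul_comm, Matrix.trace_smul, rotCoeff, smul_eq_mul]
  ring

/-- The choice of `U_Q` need not be continuous in `Q`, but the conjugation is polynomial in the
entries of `Q`. -/
theorem continuous_rotate {n : ℕ} (X : Op n) : Continuous fun Q : Orth n => rotate Q X := by
  have hg : ∀ m, Continuous fun Q : Orth n => rotate Q (gam m) := by
    intro m
    simp only [rotate_gam]
    refine continuous_finsetSum _ fun l _ => ?_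
    have : Continuous fun Q : Orth n => Q.1 l m :=
      Continuous.matrix_elem continuous_subtype_val l m
    exact (Complex.continuous_ofReal.comp this).smul continuous_const
  have hs : ∀ s, Continuous fun Q : Orth n => rotate Q (majorana s) := by
    intro s
    simp only [rotate_majorana]
    have h := continuous_list_prod (s.sort) fun m _ => hg m
    fun_prop
  rw [majorana_expansion X]
  simp only [map_sum, map_smul]
  fun_prop

theorem continuous_rotCoeff {n : ℕ} (t s : Finset (Fin (2 * n))) :
    Continuous fun Q : Orth n => rotCoeff Q t s :=
  (Continuous.matrix_trace (continuous_const.mul (continuous_rotate _))).const_mul _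

/-! ### Diagonal Majorana operators -/

/-- `A` is, up to phases, the permutation matrix of the bit flips `v`. -/
def IsShift {n : ℕ} (A : Op n) (v : Bits n) : Prop :=
  ∀ x y, ‖A x y‖ = if x = y + v then 1 else 0

theorem IsShift.mul {n : ℕ} {A B : Op n} {v w : Bits n} (hA : IsShift A v) (hB : IsShift B w) :
    IsShift (A * B) (w + v) := by
  intro x y
  have h : (A * B) x y = A x (y + w) * B (y + w) y := by
    rw [Matrix.mul_apply]
    refine Finset.sum_eq_single _ (fun z _ hz => ?_) (by simp)
    have := hB z y
    rw [if_neg hz, norm_eq_zero] at this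
    rw [this, mul_zero]
  rw [h, norm_mul, hA, hB, if_pos rfl, mul_one, add_assoc]

theorem isShift_one {n : ℕ} : IsShift (1 : Op n) 0 := by
  intro x y
  rw [Matrix.one_apply, add_zero]
  split_ifs <;> simp

theorem IsShift.smul {n : ℕ} {A : Op n} {v : Bits n} (hA : IsShift A v) {c : ℂ} (hc : ‖c‖ = 1) :
    IsShift (c • A) v := by
  intro x y
  rw [Matrix.smul_apply, norm_smul, hc, one_mul, hA]

/-- Every tensor factor has entries of modulus 0 or 1, so the modulus of the product is a
conjunction of one-site conditions. -/
theorem norm_annih {n : ℕ} (p : Fin n) (x y : Bits n) :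
    ‖annih p x y‖ = if x p = 0 ∧ x = y + Pi.single p 1 then 1 else 0 := by
  have h : ∀ q, ‖(if q < p then pauliZ else if q = p then lowering else 1 :
      Matrix (Fin 2) (Fin 2) ℂ) (x q) (y q)‖ =
      if ((q = p → x p = 0) ∧ x q = y q + (Pi.single p 1 : Bits n) q) then 1 else 0 := by
    intro q
    rcases lt_trichotomy q p with h | rfl | h
    · rw [if_pos h, Pi.single_eq_of_ne h.ne]
      simp only [h.ne, false_imp_iff, true_and, add_zero]
      generalize x q = i
      generalize y q = j
      fin_cases i <;> fin_cases j <;> simp [pauliZ]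
    · rw [if_neg (lt_irrefl _), if_pos rfl, Pi.single_eq_same]
      simp only [true_imp_iff]
      generalize x q = i
      generalize y q = j
      fin_cases i <;> fin_cases j <;> simp [lowering]
    · rw [if_neg h.not_gt, if_neg h.ne', Pi.single_eq_of_ne h.ne']
      simp only [h.ne', false_imp_iff, true_and, add_zero, Matrix.one_apply]
      split_ifs <;> simp
  rw [annih, tensorOp, Matrix.of_apply, norm_prod]
  simp only [h]
  rw [Finset.prod_ite_zero]
  simp only [Finset.prod_const_one]
  congr 1
  simp only [Finset.mem_univ, true_imp_iff, forall_and, forall_eq, funext_iff, Pi.add_apply]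

theorem isShift_gam {n : ℕ} (m : Fin (2 * n)) : IsShift (gam m) (Pi.single (mode m) 1) := by
  intro x y
  set p := mode m
  have h1 := norm_annih p x y
  have h2 := norm_annih p y x
  have hxy : y = x + Pi.single p 1 ↔ x = y + Pi.single p 1 := by
    have : (Pi.single p 1 : Bits n) + Pi.single p 1 = 0 := by
      rw [← Pi.single_add]
      simp
    constructor <;> rintro rfl <;> rw [add_assoc, this, add_zero]
  simp only [hxy] at h2
  -- At each position at most one of `a_p` and `a_p†` has a nonzero entry, so their combination
  -- cannot cancel. The values `ε = 1` and `ε = -1` serve even and odd Majorana indices.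
  have key : ∀ ε : ℂ, ‖ε‖ = 1 →
      ‖annih p x y + ε * star (annih p y x)‖ = if x = y + Pi.single p 1 then 1 else 0 := by
    intro ε hε
    by_cases h : x = y + Pi.single p 1
    · simp only [eq_true h, and_true, if_true] at h1 h2 ⊢
      have hp : x p = y p + 1 := by
        have := congrFun h p
        simpa using this
      rcases Fin.exists_fin_two.1 ⟨x p, rfl⟩ with h0 | h0
      · have h3 : y p ≠ 0 := by
          intro h3
          rw [h3, h0] at hp
          exact absurd hp (by decide)
        rw [if_neg h3, norm_eq_zero] at h2
        rw [h2, star_zero, mul_zero, add_zero, h1, if_pos h0]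
      · have h3 : y p = 0 := by
          rw [h0] at hp
          revert hp
          generalize y p = j
          fin_cases j <;> simp
        rw [if_neg (by rw [h0]; decide), norm_eq_zero] at h1
        rw [h1, zero_add, norm_mul, hε, norm_star, h2, if_pos h3, one_mul]
    · simp only [h, and_false, if_false, norm_eq_zero] at h1 h2 ⊢
      simp [h1, h2]
  unfold gam
  by_cases hm : m.val % 2 = 0
  · rw [if_pos hm, ← key 1 (by simp), one_mul]
    rfl
  · rw [if_neg hm, ← key (-1) (by simp), Matrix.smul_apply, norm_smul, norm_neg, Complex.norm_I,
      one_mul, Matrix.sub_apply, neg_one_mul, ← sub_eq_add_neg]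
    rfl

theorem exists_isShift_majorana {n : ℕ} (s : Finset (Fin (2 * n))) :
    ∃ v, IsShift (majorana s) v := by
  have h : ∀ l : List (Fin (2 * n)), ∃ v, IsShift (l.map gam).prod v := by
    intro l
    induction l with
    | nil => exact ⟨0, isShift_one⟩
    | cons a l ih =>
      obtain ⟨v, hv⟩ := ih
      exact ⟨_, by simpa using (isShift_gam a).mul hv⟩
  obtain ⟨v, hv⟩ := h s.sort
  exact ⟨v, hv.smul (by simp)⟩

/-- `Γ_s` is diagonal in the computational basis. -/
def IsDiagonal {n : ℕ} (s : Finset (Fin (2 * n))) : Prop := majorana s 0 0 ≠ 0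

open Classical in
-- A phased bit-flip matrix is either diagonal or has zero diagonal, so dephasing keeps or kills it,
-- and the entry at `(0, 0)` decides which.
theorem measZ_majorana {n : ℕ} (s : Finset (Fin (2 * n))) :
    measZ n (majorana s) = if IsDiagonal s then majorana s else 0 := by
  obtain ⟨v, hv⟩ := exists_isShift_majorana s
  have h0 : IsDiagonal s ↔ v = 0 := by
    rw [IsDiagonal, ← norm_ne_zero_iff, hv, zero_add]
    simp [eq_comm]
  ext x y
  simp only [measZ, LinearMap.comp_apply,
    Matrix.diagonalLinearMap_apply, h0]
  split_ifs with h
  · subst h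
    by_cases hxy : x = y
    · subst hxy; simp
    · have := hv x y
      rw [add_zero, if_neg hxy, norm_eq_zero] at this
      simp [hxy, this]
  · by_cases hxy : x = y
    · subst hxy
      have := hv x x
      rw [if_neg (by simpa using h), norm_eq_zero] at this
      simp [this]
    · simp [hxy]

open Classical in
theorem majorana_diag_sq {n : ℕ} (s : Finset (Fin (2 * n))) (b : Bits n) :
    majorana s b b * majorana s b b = if IsDiagonal s then 1 else 0 := by
  obtain ⟨v, hv⟩ := exists_isShift_majorana s
  have h0 : IsDiagonal s ↔ v = 0 := by
    rw [IsDiagonal, ← norm_ne_zero_iff, hv, zero_add]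
    simp [eq_comm]
  have hr : star (majorana s b b) = majorana s b b := by
    rw [← Matrix.conjTranspose_apply, majorana_conjTranspose]
  have hn : majorana s b b * majorana s b b = ((‖majorana s b b‖ ^ 2 : ℝ) : ℂ) := by
    nth_rewrite 1 [← hr]
    push_cast
    exact Complex.conj_mul' _
  rw [hn, hv]
  simp only [h0, left_eq_add]
  split_ifs <;> simp

/-! ### Projectors and the shadow channel -/

theorem irrepProj_apply (n m : ℕ) (X : Op n) : irrepProj n m X =
    ∑ s ∈ (Finset.univ : Finset (Fin (2 * n))).powersetCard m,
      (((2 : ℂ) ^ n)⁻¹ * (majorana s * X).trace) • majorana s := by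
  simp [irrepProj, LinearMap.sum_apply, majorana_conjTranspose, smul_smul]

theorem trace_majorana_irrepProj {n m : ℕ} (s : Finset (Fin (2 * n))) (X : Op n) :
    (majorana s * irrepProj n m X).trace = if s.card = m then (majorana s * X).trace else 0 := by
  rw [irrepProj_apply]
  simp only [Finset.mul_sum, Matrix.trace_sum, mul_smul_comm, Matrix.trace_smul, smul_eq_mul,
    trace_majorana_mul, mul_ite, mul_zero, Finset.sum_ite_eq, Finset.mem_powersetCard,
    Finset.subset_univ, true_and]
  split_ifs
  · field_simp
  · rfl

theorem irrepProj_majorana {n m : ℕ} (s : Finset (Fin (2 * n))) :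
    irrepProj n m (majorana s) = if s.card = m then majorana s else 0 := by
  rw [irrepProj_apply]
  simp only [trace_majorana_mul, mul_ite, mul_zero, ite_smul, zero_smul, Finset.sum_ite_eq',
    Finset.mem_powersetCard, Finset.subset_univ, true_and]
  split_ifs <;> simp

/-- `F ∘ Π_m` is a sum of rank-one maps, and the trace of each is its functional evaluated at its
vector. -/
theorem trace_comp_irrepProj {n m : ℕ} (F : Op n →ₗ[ℂ] Op n) :
    LinearMap.trace ℂ (Op n) (F ∘ₗ irrepProj n m) =
      ((2 : ℂ) ^ n)⁻¹ * ∑ s ∈ (Finset.univ : Finset (Fin (2 * n))).powersetCard m,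
        (majorana s * F (majorana s)).trace := by
  have h : F ∘ₗ irrepProj n m = ∑ s ∈ (Finset.univ : Finset (Fin (2 * n))).powersetCard m,
      ((2 : ℂ) ^ n)⁻¹ • ((Matrix.traceLinearMap (Bits n) ℂ ℂ).comp
        (LinearMap.mulLeft ℂ (majorana s))).smulRight (F (majorana s)) := by
    ext1 X
    simp [irrepProj_apply, LinearMap.sum_apply, smul_smul]
  rw [h, map_sum, Finset.mul_sum]
  refine Finset.sum_congr rfl fun s _ => ?_
  rw [map_smul, LinearMap.trace_smulRight]
  simp

open Classical in
/-- The diagonal Majorana operators of degree `m`. -/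
def diagSets (n m : ℕ) : Finset (Finset (Fin (2 * n))) :=
  ((Finset.univ : Finset (Fin (2 * n))).powersetCard m).filter IsDiagonal

theorem trace_irrepProj (n m : ℕ) :
    LinearMap.trace ℂ (Op n) (irrepProj n m) = ((2 * n).choose m : ℂ) := by
  have h := trace_comp_irrepProj (n := n) (m := m) LinearMap.id
  rw [LinearMap.id_comp] at h
  rw [h]
  simp only [LinearMap.id_apply, majorana_mul_self, Matrix.trace_one, Finset.sum_const,
    Finset.card_powersetCard, Finset.card_univ, Fintype.card_fin, nsmul_eq_mul]
  simp
  field_simp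

theorem trace_measZ_irrepProj (n m : ℕ) :
    LinearMap.trace ℂ (Op n) (measZ n ∘ₗ irrepProj n m) = ((diagSets n m).card : ℂ) := by
  classical
  rw [trace_comp_irrepProj, diagSets, Finset.card_filter, Nat.cast_sum, Finset.mul_sum]
  refine Finset.sum_congr rfl fun s _ => ?_
  rw [measZ_majorana]
  split_ifs
  · simp [majorana_mul_self]
  · simp

theorem shadowEigenvalue_eq (n m : ℕ) :
    shadowEigenvalue n m = ((diagSets n m).card : ℂ) / ((2 * n).choose m : ℂ) := by
  rw [shadowEigenvalue, trace_measZ_irrepProj, trace_irrepProj]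

theorem trace_channel_measZ_irrepProj {n m : ℕ} (E : Op n →ₗ[ℂ] Op n) :
    LinearMap.trace ℂ (Op n) (E ∘ₗ measZ n ∘ₗ irrepProj n m) =
      ((2 : ℂ) ^ n)⁻¹ * ∑ s ∈ (Finset.univ : Finset (Fin (2 * n))).powersetCard m,
        ∑ b, E (majorana s) b b * majorana s b b := by
  classical
  rw [← LinearMap.comp_assoc, trace_comp_irrepProj]
  congr 1
  refine Finset.sum_congr rfl fun s _ => ?_
  rw [LinearMap.comp_apply, measZ_majorana]
  have hs := measZ_majorana s
  split_ifs at hs ⊢ with h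
  -- For diagonal `Γ_s` only the diagonal of `E Γ_s` enters the trace. Otherwise both sides vanish,
  -- so the sum may run over all sets of the given size.
  · rw [Matrix.trace_mul_comm]
    nth_rewrite 2 [← hs]
    simp [measZ, Matrix.trace, Matrix.mul_apply, Matrix.diagonal_apply]
  · have hb : ∀ b, majorana s b b = 0 := fun b => by
      have := congrFun (congrFun hs b) b
      simpa [measZ] using this
    simp [hb]

theorem trace_majorana_shadowInverse {n : ℕ} (s : Finset (Fin (2 * n))) (X : Op n) :
    (majorana s * shadowInverse n X).trace =
      (shadowEigenvalue n s.card)⁻¹ * (majorana s * X).trace := by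
  have hs : s.card < 2 * n + 1 := Nat.lt_succ_of_le (by simpa using s.card_le_univ)
  simp [shadowInverse, LinearMap.sum_apply, Finset.mul_sum, Matrix.trace_sum,
    trace_majorana_irrepProj, hs]

/-- Cyclicity of the trace moves the rotation from `|b⟩⟨b|` to `Γ_s`. -/
theorem trace_majorana_snapshot {n : ℕ} (s : Finset (Fin (2 * n))) (Q : Orth n) (b : Bits n) :
    (majorana s * snapshot Q b).trace =
      (shadowEigenvalue n s.card)⁻¹ * rotate Q (majorana s) b b := by
  rw [snapshot, trace_majorana_shadowInverse, ← mul_assoc, ← mul_assoc, Matrix.trace_mul_comm,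
    ← mul_assoc, ← mul_assoc, rotate_apply]
  congr 1
  rw [Matrix.trace_mul_single]
  simp

/-! ### The symmetry operators -/

/-- The Majorana indices `{2p, 2p + 1}` of the mode `p`. -/
def pairSet {n : ℕ} (p : Fin n) : Finset (Fin (2 * n)) :=
  {⟨2 * p.val, by omega⟩, ⟨2 * p.val + 1, by omega⟩}

theorem card_pairSet {n : ℕ} (p : Fin n) : (pairSet p).card = 2 :=
  Finset.card_pair (by simp)

theorem mem_pairSet {n : ℕ} {p : Fin n} {m : Fin (2 * n)} : m ∈ pairSet p ↔ mode m = p := by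
  simp only [pairSet, Finset.mem_insert, Finset.mem_singleton, mode, Fin.ext_iff]
  omega

theorem pairSet_injective {n : ℕ} : Function.Injective (pairSet : Fin n → _) := by
  intro p q h
  have : (⟨2 * p.val, by omega⟩ : Fin (2 * n)) ∈ pairSet q := by rw [← h]; simp [pairSet]
  rw [mem_pairSet] at this
  rw [← this]
  simp [mode]

theorem disjoint_pairSet {n : ℕ} {p q : Fin n} (h : p ≠ q) : Disjoint (pairSet p) (pairSet q) := by
  rw [Finset.disjoint_left]
  intro m h1 h2
  exact h ((mem_pairSet.1 h1).symm.trans (mem_pairSet.1 h2))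

theorem sort_pairSet {n : ℕ} (p : Fin n) : (pairSet p).sort =
    [⟨2 * p.val, by omega⟩, ⟨2 * p.val + 1, by omega⟩] := by
  have := (List.toFinset_sort (r := (· ≤ ·)) (l := [(⟨2 * p.val, by omega⟩ : Fin (2 * n)),
    ⟨2 * p.val + 1, by omega⟩]) (by simp [Fin.ext_iff])).2 (List.pairwise_pair.2 (Fin.mk_le_mk.2 (by omega)))
  rw [← this]
  congr 1
  ext
  simp [pairSet]

theorem sort_pairSet_union {n : ℕ} {p q : Fin n} (h : p < q) : (pairSet p ∪ pairSet q).sort =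
    (pairSet p).sort ++ (pairSet q).sort := by
  have h' : p.val < q.val := h
  have h1 : 2 * p.val < 2 * n := by omega
  have h2 : 2 * p.val + 1 < 2 * n := by omega
  have h3 : 2 * q.val < 2 * n := by omega
  have h4 : 2 * q.val + 1 < 2 * n := by omega
  simp only [sort_pairSet]
  have hp : List.Pairwise (· < ·) ([(⟨2 * p.val, h1⟩ : Fin (2 * n)), ⟨2 * p.val + 1, h2⟩] ++
      [⟨2 * q.val, h3⟩, ⟨2 * q.val + 1, h4⟩]) := by
    simp only [List.cons_append, List.nil_append, List.pairwise_cons, List.mem_cons,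
      List.not_mem_nil, or_false, forall_eq_or_imp, forall_eq, Fin.mk_lt_mk, List.Pairwise.nil,
      and_true, false_imp_iff, implies_true]
    omega
  have := (List.toFinset_sort (r := (· ≤ ·)) (hp.imp fun h => h.ne)).2 (hp.imp fun h => h.le)
  rw [← this, List.toFinset_append]
  congr 1
  ext
  simp [pairSet]

/-- This is `Z_p = 1 - 2 a_p† a_p`, the link between the Majorana basis and particle number. -/
theorem majorana_pairSet {n : ℕ} (p : Fin n) :
    majorana (pairSet p) = 1 - (2 : ℂ) • ((annih p).conjTranspose * annih p) := by
  have h1 : annih p * annih p = 0 := by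
    have h := annih_anticomm p p
    rw [← two_smul ℂ] at h
    exact (smul_eq_zero.1 h).resolve_left two_ne_zero
  have h2 : (annih p).conjTranspose * (annih p).conjTranspose = 0 := by
    rw [← Matrix.conjTranspose_mul, h1, Matrix.conjTranspose_zero]
  have h3 := annih_conj_anticomm p p
  rw [if_pos rfl] at h3
  have m0 : mode (⟨2 * p.val, by omega⟩ : Fin (2 * n)) = p := by simp [mode]
  have m1 : mode (⟨2 * p.val + 1, by omega⟩ : Fin (2 * n)) = p := by
    simp only [mode, Fin.ext_iff]; omega
  have g0 : gam (⟨2 * p.val, by omega⟩ : Fin (2 * n)) = annih p + (annih p).conjTranspose := by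
    simp [gam, m0]
  have g1 : gam (⟨2 * p.val + 1, by omega⟩ : Fin (2 * n)) =
      (-Complex.I) • (annih p - (annih p).conjTranspose) := by
    simp [gam, m1]
  rw [majorana, card_pairSet, sort_pairSet]
  simp only [List.map_cons, List.map_nil, List.prod_cons, List.prod_nil, mul_one, g0, g1,
    Nat.choose_self, pow_one, mul_smul_comm, smul_smul]
  rw [← h3, two_smul]
  have : -Complex.I * -Complex.I = -1 := by simp
  rw [this, neg_one_smul, add_mul, mul_sub, mul_sub, h1, h2]
  abel

theorem majorana_pairSet_union {n : ℕ} {p q : Fin n} (h : p ≠ q) :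
    majorana (pairSet p ∪ pairSet q) = majorana (pairSet p) * majorana (pairSet q) := by
  have key : ∀ p q : Fin n, p < q →
      majorana (pairSet p ∪ pairSet q) = majorana (pairSet p) * majorana (pairSet q) := by
    intro p q h
    rw [majorana, majorana, majorana, sort_pairSet_union h, List.map_append, List.prod_append,
      smul_mul_smul_comm, Finset.card_union_of_disjoint (disjoint_pairSet h.ne), card_pairSet,
      card_pairSet]
    congr 1
    -- The phases agree: `(-i)^6 = (-i)(-i) = -1`.
    have : Nat.choose 4 2 = 6 := rfl
    simp [this, show (-Complex.I) ^ 6 = ((-Complex.I) * (-Complex.I)) ^ 3 by ring]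
    norm_num
  rcases lt_or_gt_of_ne h with h | h
  · exact key p q h
  · rw [Finset.union_comm, ← majorana_conjTranspose, key q p h, Matrix.conjTranspose_mul,
      majorana_conjTranspose, majorana_conjTranspose]

theorem sum_majorana_pairSet (n : ℕ) :
    ∑ p : Fin n, majorana (pairSet p) = (n : ℂ) • 1 - (2 : ℂ) • numberOp n := by
  simp only [majorana_pairSet, Finset.sum_sub_distrib, numberOp, Finset.smul_sum]
  simp [Nat.cast_smul_eq_nsmul]

theorem numberOp_eq (n : ℕ) : numberOp n =
    (n / 2 : ℂ) • majorana ∅ - (1 / 2 : ℂ) • ∑ p : Fin n, majorana (pairSet p) := by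
  rw [sum_majorana_pairSet, smul_sub, smul_smul, smul_smul, majorana_empty]
  norm_num
  rw [show (1 / 2 : ℂ) * n = n / 2 by ring]
  abel

/-- Squaring `∑ Z_p` leaves the `n` terms `Z_p² = 1` and the quartic terms over ordered pairs; the
latter give the degree-4 part of `N²`. -/
theorem sum_pairSet_mul (n : ℕ) :
    (∑ p : Fin n, majorana (pairSet p)) * (∑ p : Fin n, majorana (pairSet p)) =
      (n : ℂ) • majorana ∅ + ∑ p : Fin n, ∑ q ∈ Finset.univ.erase p,
        majorana (pairSet p ∪ pairSet q) := by
  rw [Finset.sum_mul_sum]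
  have : ∀ p : Fin n, ∑ q, majorana (pairSet p) * majorana (pairSet q) =
      majorana ∅ + ∑ q ∈ Finset.univ.erase p, majorana (pairSet p ∪ pairSet q) := by
    intro p
    rw [← Finset.add_sum_erase _ _ (Finset.mem_univ p), majorana_mul_self, majorana_empty]
    congr 1
    refine Finset.sum_congr rfl fun q hq => ?_
    rw [majorana_pairSet_union (Finset.ne_of_mem_erase hq).symm]
  simp only [this, Finset.sum_add_distrib]
  simp [Nat.cast_smul_eq_nsmul]

theorem sym2_eq (n : ℕ) : sym2 n = (-(1 / 2) : ℂ) • ∑ p : Fin n, majorana (pairSet p) := by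
  rw [sym2, numberOp_eq, map_sub, map_smul, map_smul, map_sum]
  simp [irrepProj_majorana, card_pairSet]

theorem card_pairSet_union {n : ℕ} {p q : Fin n} (h : p ≠ q) :
    (pairSet p ∪ pairSet q).card = 4 := by
  rw [Finset.card_union_of_disjoint (disjoint_pairSet h), card_pairSet, card_pairSet]

theorem numberOp_sq (n : ℕ) : numberOp n ^ 2 = (n ^ 2 / 4 + n / 4 : ℂ) • majorana ∅
    - (n / 2 : ℂ) • ∑ p : Fin n, majorana (pairSet p)
    + (1 / 4 : ℂ) • ∑ p : Fin n, ∑ q ∈ Finset.univ.erase p, majorana (pairSet p ∪ pairSet q) := by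
  have h := sum_pairSet_mul n
  rw [← sub_eq_iff_eq_add'] at h
  rw [← h, numberOp_eq, majorana_empty]
  generalize ∑ p : Fin n, majorana (pairSet p) = Z
  rw [sq, sub_mul, mul_sub, mul_sub]
  simp only [smul_mul_smul_comm, mul_one, one_mul]
  module

theorem sym4_eq (n : ℕ) : sym4 n =
    (1 / 4 : ℂ) • ∑ p : Fin n, ∑ q ∈ Finset.univ.erase p, majorana (pairSet p ∪ pairSet q) := by
  have h2 : irrepProj n 4 (∑ p : Fin n, majorana (pairSet p)) = 0 := by
    simp [irrepProj_majorana, card_pairSet]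
  have h4 : irrepProj n 4 (∑ p : Fin n, ∑ q ∈ Finset.univ.erase p,
      majorana (pairSet p ∪ pairSet q)) =
      ∑ p : Fin n, ∑ q ∈ Finset.univ.erase p, majorana (pairSet p ∪ pairSet q) := by
    simp only [map_sum]
    refine Finset.sum_congr rfl fun p _ => Finset.sum_congr rfl fun q hq => ?_
    rw [irrepProj_majorana, if_pos (card_pairSet_union (Finset.ne_of_mem_erase hq).symm)]
  rw [sym4, numberOp_sq, map_add, map_sub, map_smul, map_smul, map_smul, h2, h4,
    irrepProj_majorana]
  simp

theorem trace_sym2_mul {n η : ℕ} {ρ : Op n} (hρ : ρ.trace = 1)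
    (hN : numberOp n * ρ = (η : ℂ) • ρ) : (sym2 n * ρ).trace = idealSym2 n η := by
  rw [sym2_eq, sum_majorana_pairSet, smul_mul_assoc, sub_mul, smul_mul_assoc, smul_mul_assoc, hN]
  simp [hρ, idealSym2, Matrix.trace_smul, Matrix.trace_sub]
  ring

theorem trace_sym4_mul {n η : ℕ} {ρ : Op n} (hρ : ρ.trace = 1)
    (hN : numberOp n * ρ = (η : ℂ) • ρ) : (sym4 n * ρ).trace = idealSym4 n η := by
  have h := sum_pairSet_mul n
  rw [← sub_eq_iff_eq_add', sum_majorana_pairSet, majorana_empty] at h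
  rw [sym4_eq, ← h, smul_mul_assoc, sub_mul, mul_assoc, sub_mul, sub_mul, mul_sub]
  simp only [smul_mul_assoc, one_mul, mul_smul_comm, hN, mul_sub]
  simp only [Matrix.trace_smul, Matrix.trace_sub, hρ, smul_eq_mul, idealSym4,
    Nat.cast_choose_two ℝ]
  push_cast
  ring

/-! ### Number of diagonal Majorana operators -/

theorem isDiagonal_of_mulVec {n : ℕ} {s : Finset (Fin (2 * n))}
    (h : Matrix.mulVec (majorana s) (Pi.single 0 1) = Pi.single 0 1) : IsDiagonal s := by
  have := congrFun h 0
  simp only [Matrix.mulVec_single_one, Matrix.col_apply, Pi.single_eq_same] at this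
  rw [IsDiagonal, this]
  exact one_ne_zero

/-- The vacuum is annihilated by `a_p`, hence fixed by `1 - 2 a_p† a_p`. A Majorana operator fixing
it has `(0, 0)` entry 1, hence is diagonal. -/
theorem majorana_pairSet_mulVec {n : ℕ} (p : Fin n) :
    Matrix.mulVec (majorana (pairSet p)) (Pi.single (0 : Bits n) (1 : ℂ)) = Pi.single 0 1 := by
  have : Matrix.mulVec (annih p) (Pi.single (0 : Bits n) (1 : ℂ)) = 0 := by
    ext x
    simp only [Matrix.mulVec_single_one, Matrix.col_apply, Pi.zero_apply]
    rw [← norm_eq_zero, norm_annih]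
    refine if_neg fun h => ?_
    have h1 := congrFun h.2 p
    rw [h.1] at h1
    simp at h1
  rw [majorana_pairSet, Matrix.sub_mulVec, Matrix.one_mulVec, Matrix.smul_mulVec,
    ← Matrix.mulVec_mulVec, this]
  simp

theorem isDiagonal_pairSet {n : ℕ} (p : Fin n) : IsDiagonal (pairSet p) :=
  isDiagonal_of_mulVec (majorana_pairSet_mulVec p)

theorem isDiagonal_pairSet_union {n : ℕ} {p q : Fin n} (h : p ≠ q) :
    IsDiagonal (pairSet p ∪ pairSet q) :=
  isDiagonal_of_mulVec (by rw [majorana_pairSet_union h, ← Matrix.mulVec_mulVec,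
    majorana_pairSet_mulVec, majorana_pairSet_mulVec])

/-- Lower bounds on the number of diagonal operators suffice, since only upper bounds on `1/f_m` are
needed. -/
theorem le_card_diagSets_two (n : ℕ) : n ≤ (diagSets n 2).card := by
  classical
  calc n = (Finset.univ.image (pairSet : Fin n → _)).card := by
        rw [Finset.card_image_of_injective _ pairSet_injective]; simp
    _ ≤ _ := Finset.card_le_card fun s hs => by
        obtain ⟨p, -, rfl⟩ := Finset.mem_image.1 hs
        simp [diagSets, card_pairSet, isDiagonal_pairSet]

theorem le_card_diagSets_four (n : ℕ) : n.choose 2 ≤ (diagSets n 4).card := by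
  classical
  have hmem : ∀ (A : Finset (Fin n)) m, m ∈ A.biUnion pairSet ↔ mode m ∈ A := by
    intro A m
    simp [mem_pairSet]
  calc n.choose 2 = (((Finset.univ : Finset (Fin n)).powersetCard 2).image
          fun A => A.biUnion pairSet).card := by
        rw [Finset.card_image_of_injective]
        · simp
        · intro A B h
          ext p
          have h1 : mode (⟨2 * p.val, by omega⟩ : Fin (2 * n)) = p := by simp [mode]
          rw [← h1, ← hmem, ← hmem]
          exact iff_of_eq (congrArg (fun C => _ ∈ C) h)
    _ ≤ _ := Finset.card_le_card fun s hs => by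
        obtain ⟨A, hA, rfl⟩ := Finset.mem_image.1 hs
        obtain ⟨p, q, hpq, rfl⟩ := Finset.card_eq_two.1 (Finset.mem_powersetCard.1 hA).2
        simp [diagSets, card_pairSet_union hpq, isDiagonal_pairSet_union hpq]

/-! ### Haar moments -/

theorem compactSpace_orth (n : ℕ) : CompactSpace (Orth n) := by
  refine isCompact_iff_compactSpace.1 (?_ : IsCompact ((Matrix.orthogonalGroup (Fin (2 * n)) ℝ :
    Submonoid _) : Set (Matrix (Fin (2 * n)) (Fin (2 * n)) ℝ)))
  have hK : IsCompact (Set.univ.pi fun _ : Fin (2 * n) => Set.univ.pi fun _ : Fin (2 * n) =>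
      Set.Icc (-1 : ℝ) 1) :=
    isCompact_univ_pi fun _ => isCompact_univ_pi fun _ => isCompact_Icc
  refine IsCompact.of_isClosed_subset hK ?_ ?_
  · have : ((Matrix.orthogonalGroup (Fin (2 * n)) ℝ : Submonoid _) :
        Set (Matrix (Fin (2 * n)) (Fin (2 * n)) ℝ)) = {Q | Q * star Q = 1} := by
      ext Q
      exact Matrix.mem_orthogonalGroup_iff _ _
    rw [this]
    exact isClosed_eq (continuous_id.mul continuous_star) continuous_const
  · intro Q hQ i _ j _
    have := entry_norm_bound_of_unitary hQ i j
    rwa [Real.norm_eq_abs, abs_le] at this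

/-- A right translate of `μ` is again a Haar probability measure, so uniqueness applies. -/
theorem isMulRightInvariant_haar {n : ℕ} {G : Subgroup (Orth n)} [MeasurableSpace G]
    [BorelSpace G] (μ : Measure G) [μ.IsHaarMeasure] [IsProbabilityMeasure μ] [CompactSpace G] :
    μ.IsMulRightInvariant := by
  refine ⟨fun g => ?_⟩
  have : IsProbabilityMeasure (μ.map (· * g)) :=
    Measure.isProbabilityMeasure_map (by fun_prop)
  exact Measure.isHaarMeasure_eq_of_isProbabilityMeasure _ _

theorem exists_perm_map_eq {α : Type*} [Fintype α] [DecidableEq α] {s t : Finset α}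
    (h : s.card = t.card) : ∃ π : Equiv.Perm α, s.map π.toEmbedding = t := by
  have e : {x // x ∈ s} ≃ {x // x ∈ t} := Finset.equivOfCardEq h
  refine ⟨e.extendSubtype, Finset.eq_of_subset_of_card_le (fun x hx => ?_) (by simp [h])⟩
  obtain ⟨y, hy, rfl⟩ := Finset.mem_map.1 hx
  exact e.extendSubtype_mem y hy

theorem continuous_rotCoeff_coe {n : ℕ} {G : Subgroup (Orth n)} (t s : Finset (Fin (2 * n))) :
    Continuous fun Q : G => rotCoeff Q.1 t s :=
  (continuous_rotCoeff t s).comp continuous_subtype_val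

theorem integral_sum_mul_sum {X ι κ : Type*} [TopologicalSpace X] [CompactSpace X]
    [MeasurableSpace X] [BorelSpace X] (μ : Measure X) [IsFiniteMeasure μ] [Fintype ι] [Fintype κ]
    (a : ι → ℂ) (b : κ → ℂ) {f : ι → X → ℂ} {g : κ → X → ℂ} (hf : ∀ i, Continuous (f i))
    (hg : ∀ j, Continuous (g j)) :
    ∫ x, (∑ i, a i * f i x) * (∑ j, b j * g j x) ∂μ =
      ∑ i, ∑ j, a i * b j * ∫ x, f i x * g j x ∂μ := by
  have h : ∀ i j, Integrable (fun x => a i * b j * (f i x * g j x)) μ := fun i j =>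
    (((hf i).mul (hg j)).const_mul (a i * b j)).integrable_of_hasCompactSupport
      (HasCompactSupport.of_compactSpace _)
  simp only [Finset.sum_mul_sum, mul_mul_mul_comm (a _)]
  rw [integral_finsetSum _ fun i _ => integrable_finsetSum _ fun j _ => h i j]
  refine Finset.sum_congr rfl fun i _ => ?_
  rw [integral_finsetSum _ fun j _ => h i j]
  exact Finset.sum_congr rfl fun j _ => integral_const_mul _ _

section Moments

variable {n : ℕ} {G : Subgroup (Orth n)} [MeasurableSpace G] [BorelSpace G] (μ : Measure G)
  [μ.IsHaarMeasure] [IsProbabilityMeasure μ] [CompactSpace G]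

theorem integral_rotCoeff_mul (hG : ∀ Q : Orth n, IsSignedPerm Q → Q ∈ G)
    (t s t' s' : Finset (Fin (2 * n))) :
    ∫ Q : G, rotCoeff Q.1 t s * rotCoeff Q.1 t' s' ∂μ =
      if t = t' ∧ s = s' ∧ t.card = s.card then ((2 * n).choose s.card : ℂ)⁻¹ else 0 := by
  have := isMulRightInvariant_haar μ
  by_cases ht : t = t'
  swap
  · rw [if_neg fun h => ht h.1]
    obtain ⟨m, hm⟩ : ∃ m, ¬(m ∈ t ↔ m ∈ t') := by
      by_contra! h'
      exact ht (Finset.ext h')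
    -- A left flip at an index in the symmetric difference of `t` and `t'` negates the integrand; a
    -- right flip does the same for `s` and `s'`.
    refine integral_eq_zero_of_mul_left_eq_neg (g := ⟨flip m, hG _ (isSignedPerm_signedPerm _ _)⟩)
      fun Q => ?_
    simp only [Subgroup.coe_mul, rotCoeff_flip_mul]
    by_cases h3 : m ∈ t <;> by_cases h4 : m ∈ t' <;> simp_all
  by_cases hs : s = s'
  swap
  · rw [if_neg fun h => hs h.2.1]
    obtain ⟨m, hm⟩ : ∃ m, ¬(m ∈ s ↔ m ∈ s') := by
      by_contra! h'
      exact hs (Finset.ext h')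
    refine integral_eq_zero_of_mul_right_eq_neg (g := ⟨flip m, hG _ (isSignedPerm_signedPerm _ _)⟩)
      fun Q => ?_
    simp only [Subgroup.coe_mul, rotCoeff_mul_flip]
    by_cases h3 : m ∈ s <;> by_cases h4 : m ∈ s' <;> simp_all
  subst ht hs
  by_cases hc : t.card = s.card
  swap
  · simp [hc, rotCoeff_eq_zero _ hc]
  rw [if_pos ⟨rfl, rfl, hc⟩]
  -- Permutations in `G` make `I` constant on sets of size `|s|`; it vanishes for other sizes, and
  -- its total is 1 because the rows of `R(Q)` are normalized.
  set I : Finset (Fin (2 * n)) → ℂ := fun s => ∫ Q : G, rotCoeff Q.1 t s * rotCoeff Q.1 t s ∂μ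
  have hI : ∀ s', s'.card = s.card → I s' = I s := by
    intro s' h
    obtain ⟨π, hπ⟩ := exists_perm_map_eq h
    obtain ⟨ε, h1, h2⟩ := exists_rotCoeff_mul_perm π s'
    simp only [I]
    rw [← integral_mul_right_eq_self _ (⟨signedPerm π 1, hG _ (isSignedPerm_signedPerm _ _)⟩ : G)]
    simp only [Subgroup.coe_mul, h2, hπ]
    refine integral_congr_ae (.of_forall fun Q => ?_)
    simp only
    rw [mul_mul_mul_comm, h1, one_mul]
  have hsum : ∑ s', I s' = 1 := by
    simp only [I]
    rw [← integral_finsetSum]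
    · simp [sum_rotCoeff_sq]
    · exact fun s' _ => ((continuous_rotCoeff_coe t s').mul
        (continuous_rotCoeff_coe t s')).integrable_of_hasCompactSupport
        (HasCompactSupport.of_compactSpace _)
  have hsum' : ∑ s', I s' = ((2 * n).choose s.card : ℂ) * I s := by
    rw [← Finset.sum_subset (Finset.subset_univ
      ((Finset.univ : Finset (Fin (2 * n))).powersetCard s.card))]
    · rw [Finset.sum_congr rfl fun s' h => hI s' (Finset.mem_powersetCard.1 h).2]
      simp
    · intro s' _ h
      have : t.card ≠ s'.card := fun h' => h (Finset.mem_powersetCard.2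
        ⟨Finset.subset_univ _, h'.symm.trans hc⟩)
      simp [I, rotCoeff_eq_zero _ this]
  exact eq_inv_of_mul_eq_one_right (hsum'.symm.trans hsum)

/-- A right flip acts on `s` twice, so its signs cancel there and only the sign from `u` survives.
This forces `u = ∅`, where `R_{r∅} = δ_{r∅}` leaves a second moment. -/
theorem integral_rotCoeff_mul_mul (hG : ∀ Q : Orth n, IsSignedPerm Q → Q ∈ G)
    (r u t t' s : Finset (Fin (2 * n))) :
    ∫ Q : G, rotCoeff Q.1 r u * (rotCoeff Q.1 t s * rotCoeff Q.1 t' s) ∂μ =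
      if r = ∅ ∧ u = ∅ ∧ t = t' ∧ t.card = s.card then ((2 * n).choose s.card : ℂ)⁻¹ else 0 := by
  have := isMulRightInvariant_haar μ
  by_cases hu : u = ∅
  · subst hu
    by_cases hr : r = ∅
    · simp only [rotCoeff_empty, hr, if_true, one_mul, integral_rotCoeff_mul μ hG, true_and]
    · simp [rotCoeff_empty, hr]
  · rw [if_neg fun h => hu h.2.1]
    obtain ⟨m, hm⟩ := Finset.nonempty_iff_ne_empty.2 hu
    refine integral_eq_zero_of_mul_right_eq_neg (g := ⟨flip m, hG _ (isSignedPerm_signedPerm _ _)⟩)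
      fun Q => ?_
    simp only [Subgroup.coe_mul, rotCoeff_mul_flip]
    by_cases h3 : m ∈ s <;> simp_all

end Moments

/-! ### States and channels -/

theorem IsChannel.posSemidef {n : ℕ} {E : Op n →ₗ[ℂ] Op n} (hE : IsChannel E) {X : Op n}
    (hX : X.PosSemidef) : (E X).PosSemidef := by
  -- Complete positivity with a one-dimensional ancilla.
  have h := hE.1 1 (X.submatrix Prod.snd Prod.snd) (hX.submatrix _)
  exact h.submatrix fun i : Bits n => ((0 : Fin 1), i)

theorem diag_eq_re_of_posSemidef {n : ℕ} {X : Op n} (hX : X.PosSemidef) (b : Bits n) :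
    (((X b b).re : ℝ) : ℂ) = X b b ∧ 0 ≤ (X b b).re := by
  have h := Complex.le_def.1 (hX.diag_nonneg (i := b))
  exact ⟨Complex.ext rfl (by simpa using h.2), h.1⟩

theorem rotate_posSemidef {n : ℕ} (Q : Orth n) {X : Op n} (hX : X.PosSemidef) :
    (rotate Q X).PosSemidef := hX.mul_mul_conjTranspose_same _

theorem outcomeProb_eq {n : ℕ} (ρ : Op n) (E : Op n →ₗ[ℂ] Op n) (Q : Orth n) (b : Bits n) :
    outcomeProb ρ E Q b = (E (rotate Q ρ) b b).re := rfl

theorem ofReal_outcomeProb {n : ℕ} {ρ : Op n} (hρ : IsState ρ) {E : Op n →ₗ[ℂ] Op n}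
    (hE : IsChannel E) (Q : Orth n) (b : Bits n) :
    ((outcomeProb ρ E Q b : ℝ) : ℂ) = E (rotate Q ρ) b b :=
  (diag_eq_re_of_posSemidef (hE.posSemidef (rotate_posSemidef Q hρ.1)) b).1

theorem outcomeProb_nonneg {n : ℕ} {ρ : Op n} (hρ : IsState ρ) {E : Op n →ₗ[ℂ] Op n}
    (hE : IsChannel E) (Q : Orth n) (b : Bits n) : 0 ≤ outcomeProb ρ E Q b :=
  (diag_eq_re_of_posSemidef (hE.posSemidef (rotate_posSemidef Q hρ.1)) b).2

theorem sum_outcomeProb {n : ℕ} {ρ : Op n} (hρ : IsState ρ) {E : Op n →ₗ[ℂ] Op n}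
    (hE : IsChannel E) (Q : Orth n) : ∑ b, outcomeProb ρ E Q b = 1 := by
  have h := hE.2 (rotate Q ρ)
  rw [trace_rotate, hρ.2, Matrix.trace] at h
  simpa [outcomeProb_eq] using congrArg Complex.re h

theorem continuous_outcomeProb {n : ℕ} (ρ : Op n) (E : Op n →ₗ[ℂ] Op n) (b : Bits n) :
    Continuous fun Q : Orth n => outcomeProb ρ E Q b := by
  have h : Continuous fun Q : Orth n => E (rotate Q ρ) :=
    (LinearMap.continuous_of_finiteDimensional E).comp (continuous_rotate ρ)
  exact Complex.continuous_re.comp (h.matrix_elem b b)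

theorem channel_rotate_apply {n : ℕ} (ρ : Op n) (E : Op n →ₗ[ℂ] Op n) (Q : Orth n) (b : Bits n) :
    E (rotate Q ρ) b b = ∑ p : Finset (Fin (2 * n)) × Finset (Fin (2 * n)),
      (((2 : ℂ) ^ n)⁻¹ * (majorana p.1 * ρ).trace * E (majorana p.2) b b) * rotCoeff Q p.2 p.1 := by
  conv_lhs => rw [majorana_expansion ρ]
  rw [Fintype.sum_prod_type]
  simp only [map_sum, map_smul, rotate_majorana_eq_sum, Matrix.sum_apply, Matrix.smul_apply,
    smul_eq_mul, Finset.mul_sum]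
  exact Finset.sum_congr rfl fun s _ => Finset.sum_congr rfl fun t _ => by ring

theorem rotate_majorana_apply {n : ℕ} (Q : Orth n) (s : Finset (Fin (2 * n))) (b : Bits n) :
    rotate Q (majorana s) b b = ∑ t, majorana t b b * rotCoeff Q t s := by
  rw [rotate_majorana_eq_sum]
  simp [Matrix.sum_apply, mul_comm]

theorem ofReal_rotate_majorana_re {n : ℕ} (Q : Orth n) (s : Finset (Fin (2 * n))) (b : Bits n) :
    (((rotate Q (majorana s) b b).re : ℝ) : ℂ) = rotate Q (majorana s) b b := by
  refine Complex.conj_eq_iff_re.1 ?_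
  have h := rotate_conjTranspose Q (majorana s)
  rw [majorana_conjTranspose] at h
  exact congrFun (congrFun h b) b

theorem abs_rotate_majorana_re_le {n : ℕ} (Q : Orth n) (s : Finset (Fin (2 * n))) (b : Bits n) :
    |(rotate Q (majorana s) b b).re| ≤ 1 := by
  have h : rotate Q (majorana s) ∈ Matrix.unitaryGroup (Bits n) ℂ := by
    rw [Matrix.mem_unitaryGroup_iff, Matrix.star_eq_conjTranspose, rotate_conjTranspose,
      majorana_conjTranspose, ← rotate_mul, majorana_mul_self, rotate_one]
  exact (Complex.abs_re_le_norm _).trans (entry_norm_bound_of_unitary h b b)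

theorem continuous_rotate_majorana_re {n : ℕ} (s : Finset (Fin (2 * n))) (b : Bits n) :
    Continuous fun Q : Orth n => (rotate Q (majorana s) b b).re :=
  Complex.continuous_re.comp ((continuous_rotate _).matrix_elem b b)

/-- Since `Γ_s² = 1`, the operators `1 ± Γ_s` are twice projections. Testing positive functionals on
them bounds the value at `Γ_s` by the value at `1`. -/
theorem one_add_majorana_sq {n : ℕ} (s : Finset (Fin (2 * n))) {ε : ℂ} (h1 : star ε = ε)
    (h2 : ε * ε = 1) : (1 + ε • majorana s).conjTranspose * (1 + ε • majorana s) =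
      (2 : ℂ) • (1 + ε • majorana s) := by
  rw [Matrix.conjTranspose_add, Matrix.conjTranspose_smul, majorana_conjTranspose, h1,
    Matrix.conjTranspose_one, add_mul, mul_add, mul_add, smul_mul_smul_comm, h2,
    majorana_mul_self]
  simp only [one_mul, mul_one, one_smul]
  module

theorem posSemidef_one_add_majorana {n : ℕ} (s : Finset (Fin (2 * n))) {ε : ℂ} (h1 : star ε = ε)
    (h2 : ε * ε = 1) : (1 + ε • majorana s).PosSemidef := by
  have h4 := (Matrix.posSemidef_conjTranspose_mul_self (1 + ε • majorana s)).smul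
    (show (0 : ℂ) ≤ 1 / 2 by simp)
  rw [one_add_majorana_sq s h1 h2, smul_smul] at h4
  simpa using h4

theorem trace_majorana_mul_state {n : ℕ} {ρ : Op n} (hρ : IsState ρ) (s : Finset (Fin (2 * n))) :
    (((majorana s * ρ).trace.re : ℝ) : ℂ) = (majorana s * ρ).trace ∧
      |(majorana s * ρ).trace.re| ≤ 1 := by
  have h0 : ∀ ε : ℂ, star ε = ε → ε * ε = 1 → 0 ≤ 2 * (1 + ε * (majorana s * ρ).trace) := by
    intro ε h1 h2
    have h := (hρ.1.mul_mul_conjTranspose_same (1 + ε • majorana s)).trace_nonneg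
    rw [Matrix.mul_assoc, Matrix.trace_mul_comm, Matrix.mul_assoc, one_add_majorana_sq s h1 h2] at h
    rw [Matrix.trace_mul_comm, smul_mul_assoc, add_mul, one_mul, smul_mul_assoc, Matrix.trace_smul,
      Matrix.trace_add, Matrix.trace_smul, hρ.2] at h
    exact h
  have hp := Complex.le_def.1 (h0 1 (by simp) (by simp))
  have hm := Complex.le_def.1 (h0 (-1) (by simp) (by simp))
  simp at hp hm
  refine ⟨Complex.ext rfl (by rw [Complex.ofReal_im]; linarith [hp.2]), abs_le.2 ⟨by linarith, by linarith⟩⟩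

/-! ### The single-shot estimate -/

section Estimate

variable {n : ℕ} {G : Subgroup (Orth n)}

/-- The single-shot estimate `tr(Γ_s M⁻¹(U_Q† |b⟩⟨b| U_Q))`. -/
def shotEstimate (s : Finset (Fin (2 * n))) (x : G × Bits n) : ℝ :=
  ((2 * n).choose s.card : ℝ) / (diagSets n s.card).card * (rotate x.1.1 (majorana s) x.2 x.2).re

theorem trace_majorana_snapshot_eq (s : Finset (Fin (2 * n))) (x : G × Bits n) :
    (majorana s * snapshot x.1.1 x.2).trace = (shotEstimate s x : ℂ) := by
  rw [trace_majorana_snapshot, shadowEigenvalue_eq, shotEstimate, inv_div]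
  push_cast
  rw [ofReal_rotate_majorana_re]

theorem continuous_rotate_majorana_apply (s : Finset (Fin (2 * n))) (b : Bits n) :
    Continuous fun Q : G => rotate Q.1 (majorana s) b b :=
  ((continuous_rotate _).matrix_elem b b).comp continuous_subtype_val

theorem continuous_shotEstimate (s : Finset (Fin (2 * n))) (b : Bits n) :
    Continuous fun Q : G => shotEstimate s (Q, b) :=
  ((continuous_rotate_majorana_re s b).comp continuous_subtype_val).const_mul _

theorem abs_shotEstimate_le (s : Finset (Fin (2 * n))) (x : G × Bits n) :
    |shotEstimate s x| ≤ ((2 * n).choose s.card : ℝ) / (diagSets n s.card).card := by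
  rw [shotEstimate, abs_mul, abs_of_nonneg (by positivity)]
  exact mul_le_of_le_one_right (by positivity) (abs_rotate_majorana_re_le _ _ _)

end Estimate

/-! ### The law of one experiment -/

theorem integrable_channel_mul {n : ℕ} {G : Subgroup (Orth n)} [MeasurableSpace G] [BorelSpace G]
    [CompactSpace G] (μ : Measure G) [IsFiniteMeasure μ] {ρ : Op n} {E : Op n →ₗ[ℂ] Op n} {f : G → ℂ} (hf : Continuous f) (b : Bits n) :
    Integrable (fun Q : G => E (rotate Q.1 ρ) b b * f Q) μ := by
  have h : Continuous fun Q : Orth n => E (rotate Q ρ) :=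
    (LinearMap.continuous_of_finiteDimensional E).comp (continuous_rotate ρ)
  exact (((h.matrix_elem b b).comp continuous_subtype_val).mul hf).integrable_of_hasCompactSupport
    (HasCompactSupport.of_compactSpace _)

section Shot

variable {n : ℕ} {G : Subgroup (Orth n)} [MeasurableSpace G] [BorelSpace G] (μ : Measure G)
  [IsProbabilityMeasure μ] {ρ : Op n} {E : Op n →ₗ[ℂ] Op n}

theorem measurable_of_continuous_left {h : G × Bits n → ℝ}
    (hh : ∀ b, Continuous fun Q => h (Q, b)) : Measurable h :=
  measurable_from_prod_countable_left fun b => (hh b).measurable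

theorem measurable_outcomeProb (ρ : Op n) (E : Op n →ₗ[ℂ] Op n) :
    Measurable fun x : G × Bits n => outcomeProb ρ E x.1.1 x.2 :=
  measurable_of_continuous_left fun b =>
    (continuous_outcomeProb ρ E b).comp continuous_subtype_val

theorem isProbabilityMeasure_shotLaw (hρ : IsState ρ) (hE : IsChannel E) :
    IsProbabilityMeasure (shotLaw μ ρ E) := by
  refine ⟨?_⟩
  rw [shotLaw, withDensity_apply _ MeasurableSet.univ, Measure.restrict_univ,
    lintegral_prod _ (measurable_outcomeProb ρ E).ennreal_ofReal.aemeasurable]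
  have : ∀ Q : G, ∫⁻ b, ENNReal.ofReal (outcomeProb ρ E Q.1 b) ∂Measure.count = 1 := by
    intro Q
    rw [lintegral_count, tsum_fintype,
      ← ENNReal.ofReal_sum_of_nonneg fun b _ => outcomeProb_nonneg hρ hE Q.1 b,
      sum_outcomeProb hρ hE, ENNReal.ofReal_one]
  simp [this]

theorem integral_shotLaw [CompactSpace G] (hρ : IsState ρ) (hE : IsChannel E) {h : G × Bits n → ℝ}
    (hh : ∀ b, Continuous fun Q => h (Q, b)) :
    ∫ x, h x ∂shotLaw μ ρ E = ∫ Q : G, ∑ b, outcomeProb ρ E Q.1 b * h (Q, b) ∂μ := by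
  rw [shotLaw, integral_withDensity_eq_integral_toReal_smul
    (measurable_outcomeProb ρ E).ennreal_ofReal (.of_forall fun _ => ENNReal.ofReal_lt_top)]
  simp only [ENNReal.toReal_ofReal (outcomeProb_nonneg hρ hE _ _), smul_eq_mul]
  have hc : ∀ b, Continuous fun Q : G => outcomeProb ρ E Q.1 b * h (Q, b) := fun b =>
    ((continuous_outcomeProb ρ E b).comp continuous_subtype_val).mul (hh b)
  have hb : ∀ b, ∃ C, ∀ Q : G, ‖outcomeProb ρ E Q.1 b * h (Q, b)‖ ≤ C := by
    intro b
    obtain ⟨C, hC⟩ := isCompact_univ.exists_bound_of_continuousOn (hc b).continuousOn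
    exact ⟨C, fun Q => hC Q (Set.mem_univ _)⟩
  choose C hC using hb
  rw [integral_prod]
  · simp
  · refine Integrable.of_bound (C := ∑ b, |C b|) (Measurable.aestronglyMeasurable
      (measurable_of_continuous_left (h := fun x => outcomeProb ρ E x.1.1 x.2 * h x) hc))
      (.of_forall fun x => ?_)
    exact ((hC x.2 x.1).trans (le_abs_self _)).trans
      (Finset.single_le_sum (f := fun b => |C b|) (fun b _ => abs_nonneg _) (Finset.mem_univ x.2))

variable [μ.IsHaarMeasure] [CompactSpace G]

/-- After expanding `ρ`, its rotation and `Γ_s`, the second moments retain only the `Γ_s` component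
of `ρ` and equal target sets. -/
theorem integral_channel_mul_majorana (hG : ∀ Q : Orth n, IsSignedPerm Q → Q ∈ G)
    (s : Finset (Fin (2 * n))) (b : Bits n) :
    ∫ Q : G, E (rotate Q.1 ρ) b b * rotate Q.1 (majorana s) b b ∂μ =
      ((2 * n).choose s.card : ℂ)⁻¹ * ((2 : ℂ) ^ n)⁻¹ * (majorana s * ρ).trace *
        ∑ t ∈ (Finset.univ : Finset (Fin (2 * n))).powersetCard s.card,
          E (majorana t) b b * majorana t b b := by
  simp only [channel_rotate_apply, rotate_majorana_apply]
  refine (integral_sum_mul_sum μ (fun p : Finset (Fin (2 * n)) × Finset (Fin (2 * n)) =>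
    ((2 : ℂ) ^ n)⁻¹ * (majorana p.1 * ρ).trace * E (majorana p.2) b b) (fun t => majorana t b b)
    (fun p => continuous_rotCoeff_coe p.2 p.1) (fun t => continuous_rotCoeff_coe t s)).trans ?_
  rw [Fintype.sum_prod_type, Finset.sum_comm, Finset.powersetCard_eq_filter, Finset.powerset_univ, Finset.sum_filter, Finset.mul_sum]
  refine Finset.sum_congr rfl fun t _ => ?_
  simp only [integral_rotCoeff_mul μ hG]
  rw [Finset.sum_eq_single s]
  · rw [Finset.sum_eq_single t]
    · simp only [true_and, mul_ite, mul_zero]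
      split_ifs
      · ring
      · rfl
    · intro t' _ h
      simp [h.symm]
    · simp
  · intro u _ h
    simp [h]
  · simp

theorem integral_channel_mul_majorana_sq (hG : ∀ Q : Orth n, IsSignedPerm Q → Q ∈ G)
    (s : Finset (Fin (2 * n))) (b : Bits n) :
    ∫ Q : G, E (rotate Q.1 ρ) b b * (rotate Q.1 (majorana s) b b * rotate Q.1 (majorana s) b b) ∂μ =
      ((2 * n).choose s.card : ℂ)⁻¹ * ((2 : ℂ) ^ n)⁻¹ * ρ.trace * (diagSets n s.card).card *
        E 1 b b := by
  classical
  have hsq : ∀ Q : G, rotate Q.1 (majorana s) b b * rotate Q.1 (majorana s) b b =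
      ∑ p : Finset (Fin (2 * n)) × Finset (Fin (2 * n)), (majorana p.1 b b * majorana p.2 b b) *
        (rotCoeff Q.1 p.1 s * rotCoeff Q.1 p.2 s) := by
    intro Q
    rw [rotate_majorana_apply, Finset.sum_mul_sum, Fintype.sum_prod_type]
    exact Finset.sum_congr rfl fun t _ => Finset.sum_congr rfl fun t' _ => mul_mul_mul_comm _ _ _ _
  simp only [hsq, channel_rotate_apply]
  refine (integral_sum_mul_sum μ (fun p : Finset (Fin (2 * n)) × Finset (Fin (2 * n)) =>
    ((2 : ℂ) ^ n)⁻¹ * (majorana p.1 * ρ).trace * E (majorana p.2) b b)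
    (fun p : Finset (Fin (2 * n)) × Finset (Fin (2 * n)) => majorana p.1 b b * majorana p.2 b b)
    (f := fun p Q => rotCoeff Q.1 p.2 p.1)
    (g := fun p Q => rotCoeff Q.1 p.1 s * rotCoeff Q.1 p.2 s)
    (fun p => continuous_rotCoeff_coe p.2 p.1)
    (fun p => (continuous_rotCoeff_coe p.1 s).mul (continuous_rotCoeff_coe p.2 s))).trans ?_
  simp only [integral_rotCoeff_mul_mul μ hG]
  -- Only the identity component of `ρ` survives, so the second moment depends neither on the rest
  -- of `ρ` nor, after summing over `b`, on the noise.
  rw [Finset.sum_eq_single (∅, ∅)]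
  · rw [Fintype.sum_prod_type, diagSets, Finset.card_filter, Finset.powersetCard_eq_filter,
      Finset.powerset_univ, Finset.sum_filter, Nat.cast_sum, Finset.mul_sum, Finset.sum_mul]
    refine Finset.sum_congr rfl fun t _ => ?_
    rw [Finset.sum_eq_single t]
    · simp only [true_and, majorana_diag_sq, majorana_empty, one_mul]
      split_ifs <;> simp
      ring
    · intro t' _ h
      simp [h.symm]
    · simp
  · intro p _ h
    refine Finset.sum_eq_zero fun q _ => ?_
    rw [if_neg fun h' => h (Prod.ext h'.2.1 h'.1), mul_zero]
  · simp

theorem integral_shotEstimate (hG : ∀ Q : Orth n, IsSignedPerm Q → Q ∈ G) (hρ : IsState ρ)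
    (hE : IsChannel E) (s : Finset (Fin (2 * n))) :
    ∫ x, shotEstimate s x ∂shotLaw μ ρ E = noiseRatio E s.card * (majorana s * ρ).trace.re := by
  have hr := (trace_majorana_mul_state hρ s).1
  have hch : ((2 * n).choose s.card : ℂ) ≠ 0 := by
    exact_mod_cast (Nat.choose_pos (by simpa using s.card_le_univ)).ne'
  set r := (majorana s * ρ).trace with hrdef
  have key : ((∫ x, shotEstimate s x ∂shotLaw μ ρ E : ℝ) : ℂ) =
      LinearMap.trace ℂ (Op n) (E ∘ₗ measZ n ∘ₗ irrepProj n s.card) /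
        LinearMap.trace ℂ (Op n) (measZ n ∘ₗ irrepProj n s.card) * r := by
    rw [integral_shotLaw μ hρ hE (continuous_shotEstimate s), ← integral_complex_ofReal]
    simp only [Complex.ofReal_sum, Complex.ofReal_mul, ofReal_outcomeProb hρ hE, shotEstimate,
      ofReal_rotate_majorana_re, mul_left_comm (E _ _ _)]
    simp only [← Finset.mul_sum]
    rw [integral_const_mul, integral_finsetSum _ fun b _ =>
      integrable_channel_mul μ (continuous_rotate_majorana_apply s b) b]
    simp only [integral_channel_mul_majorana μ hG]
    rw [trace_channel_measZ_irrepProj, trace_measZ_irrepProj, ← Finset.mul_sum, Finset.sum_comm,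
      ← hrdef]
    push_cast
    field_simp
  have := congrArg Complex.re key
  rw [← hr, Complex.re_mul_ofReal, Complex.ofReal_re] at this
  exact this

theorem integral_shotEstimate_sq (hG : ∀ Q : Orth n, IsSignedPerm Q → Q ∈ G) (hρ : IsState ρ)
    (hE : IsChannel E) (s : Finset (Fin (2 * n))) :
    ∫ x, shotEstimate s x ^ 2 ∂shotLaw μ ρ E =
      ((2 * n).choose s.card : ℝ) / (diagSets n s.card).card := by
  have hch : ((2 * n).choose s.card : ℂ) ≠ 0 := by
    exact_mod_cast (Nat.choose_pos (by simpa using s.card_le_univ)).ne'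
  have hE1 : ∑ b, E 1 b b = 2 ^ n := by
    have h := hE.2 1
    rw [Matrix.trace_one] at h
    simpa [Matrix.trace] using h
  have key : ((∫ x, shotEstimate s x ^ 2 ∂shotLaw μ ρ E : ℝ) : ℂ) =
      ((((2 * n).choose s.card : ℝ) / (diagSets n s.card).card : ℝ) : ℂ) := by
    rw [integral_shotLaw μ hρ hE fun b => (continuous_shotEstimate s b).pow 2,
      ← integral_complex_ofReal]
    simp only [Complex.ofReal_sum, Complex.ofReal_mul, ofReal_outcomeProb hρ hE, shotEstimate,
      ofReal_rotate_majorana_re, mul_left_comm (E _ _ _), Complex.ofReal_pow, mul_pow]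
    simp only [← Finset.mul_sum, sq (rotate _ _ _ _)]
    rw [integral_const_mul, integral_finsetSum _ fun b _ => integrable_channel_mul μ
      (f := fun Q => rotate Q.1 (majorana s) b b * rotate Q.1 (majorana s) b b)
      ((continuous_rotate_majorana_apply s b).mul (continuous_rotate_majorana_apply s b)) b]
    simp only [integral_channel_mul_majorana_sq μ hG]
    rw [← Finset.mul_sum, hE1, hρ.2]
    push_cast
    -- In a degree without diagonal operators both sides are zero by the convention `x / 0 = 0`.
    by_cases hK : ((diagSets n s.card).card : ℂ) = 0
    · simp [hK]
    · field_simp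
  exact_mod_cast key

end Shot

/-! ### The noise strength -/

theorem abs_re_channel_majorana_le {n : ℕ} {E : Op n →ₗ[ℂ] Op n} (hE : IsChannel E)
    (s : Finset (Fin (2 * n))) (b : Bits n) :
    (((E (majorana s) b b).re : ℝ) : ℂ) = E (majorana s) b b ∧
      |(E (majorana s) b b).re| ≤ (E 1 b b).re := by
  have h : ∀ ε : ℂ, star ε = ε → ε * ε = 1 → 0 ≤ E 1 b b + ε * E (majorana s) b b := by
    intro ε h1 h2
    have h := (hE.posSemidef (posSemidef_one_add_majorana s h1 h2)).diag_nonneg (i := b)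
    rwa [map_add, map_smul] at h
  have hp := Complex.le_def.1 (h 1 (by simp) (by simp))
  have hm := Complex.le_def.1 (h (-1) (by simp) (by simp))
  simp at hp hm
  refine ⟨Complex.ext rfl (by simp; linarith), abs_le.2 ⟨by linarith, by linarith⟩⟩

/-- Each diagonal `Γ_s` contributes at most `tr E(1) = 2^n`. The bound is used to keep the target
accuracy below 1, as Bernstein's inequality requires here. -/
theorem noiseRatio_le_one {n : ℕ} {E : Op n →ₗ[ℂ] Op n} (hE : IsChannel E) (m : ℕ) :
    noiseRatio E m ≤ 1 := by
  classical
  have hE1 : ∑ b, (E 1 b b).re = 2 ^ n := by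
    have h := hE.2 1
    rw [Matrix.trace_one] at h
    have := congrArg Complex.re h
    rw [Matrix.trace, Complex.re_sum] at this
    rw [show ∑ b, (E 1 b b).re = _ from this]
    norm_cast
    simp
  have hle : ∀ s : Finset (Fin (2 * n)), (∑ b, E (majorana s) b b * majorana s b b).re ≤
      2 ^ n * if IsDiagonal s then 1 else 0 := by
    intro s
    split_ifs with h
    · rw [mul_one, ← hE1, Complex.re_sum]
      refine Finset.sum_le_sum fun b _ => ?_
      have hz := majorana_diag_sq s b
      rw [if_pos h, mul_self_eq_one_iff] at hz
      have he := abs_le.1 (abs_re_channel_majorana_le hE s b).2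
      rcases hz with hz | hz <;> rw [hz] <;> simp <;> linarith
    · have : ∀ b, majorana s b b = 0 := fun b => by
        have hz := majorana_diag_sq s b
        rwa [if_neg h, mul_self_eq_zero] at hz
      simp [this]
  rw [noiseRatio, trace_measZ_irrepProj, trace_channel_measZ_irrepProj]
  have h2 : ((2 : ℂ) ^ n)⁻¹ = (((2 ^ n)⁻¹ : ℝ) : ℂ) := by push_cast; rfl
  rw [← Complex.ofReal_natCast, Complex.div_ofReal_re, h2, Complex.re_ofReal_mul, Complex.re_sum]
  refine div_le_one_of_le₀ ?_ (by positivity)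
  rw [inv_mul_le_iff₀ (by positivity), diagSets, Finset.card_filter, Nat.cast_sum, Finset.mul_sum]
  refine Finset.sum_le_sum fun s _ => (hle s).trans (le_of_eq ?_)
  push_cast
  rfl

/-! ### Bernstein's inequality -/

/-- Integrate `exp y ≤ 1 + y + y²`, valid for `|y| ≤ 1`, at `y = l (X - m)`: the linear term drops
out and the variance is at most the second moment. -/
theorem integral_exp_sub_mean_le {Ω : Type*} [MeasurableSpace Ω] (P : Measure Ω)
    [IsProbabilityMeasure P] {X : Ω → ℝ} (hX : Measurable X) {R V l : ℝ} (hR : ∀ ω, |X ω| ≤ R)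
    (hV : ∫ ω, X ω ^ 2 ∂P ≤ V) (hl : |l| * (2 * R) ≤ 1) :
    ∫ ω, Real.exp (l * (X ω - ∫ ω, X ω ∂P)) ∂P ≤ Real.exp (l ^ 2 * V) := by
  set m := ∫ ω, X ω ∂P
  have hiX : Integrable X P := .of_bound hX.aestronglyMeasurable R (.of_forall hR)
  have hiX2 : Integrable (fun ω => X ω ^ 2) P :=
    .of_bound (hX.pow_const 2).aestronglyMeasurable (R ^ 2) (.of_forall fun ω => by
      rw [Real.norm_eq_abs, abs_pow]
      exact pow_le_pow_left₀ (abs_nonneg _) (hR ω) 2)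
  have hm : |m| ≤ R := by
    simpa using norm_integral_le_of_norm_le_const (μ := P) (f := X) (.of_forall hR)
  have hlY : ∀ ω, |l * (X ω - m)| ≤ 1 := fun ω => by
    rw [abs_mul]
    refine (mul_le_mul_of_nonneg_left ?_ (abs_nonneg l)).trans hl
    linarith [abs_sub (X ω) m, hR ω]
  have hpt : ∀ ω, Real.exp (l * (X ω - m)) ≤
      (1 - l * m + l ^ 2 * m ^ 2) + (l - 2 * l ^ 2 * m) * X ω + l ^ 2 * X ω ^ 2 := fun ω => by
    have := (abs_le.1 (Real.abs_exp_sub_one_sub_id_le (hlY ω))).2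
    nlinarith
  have hi1 : Integrable (fun ω => (1 - l * m + l ^ 2 * m ^ 2) + (l - 2 * l ^ 2 * m) * X ω) P :=
    (integrable_const _).add (hiX.const_mul _)
  have hi : Integrable (fun ω => (1 - l * m + l ^ 2 * m ^ 2) + (l - 2 * l ^ 2 * m) * X ω
      + l ^ 2 * X ω ^ 2) P :=
    hi1.add (hiX2.const_mul _)
  calc ∫ ω, Real.exp (l * (X ω - m)) ∂P
      ≤ ∫ ω, ((1 - l * m + l ^ 2 * m ^ 2) + (l - 2 * l ^ 2 * m) * X ω + l ^ 2 * X ω ^ 2) ∂P :=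
        integral_mono_of_nonneg (.of_forall fun _ => (Real.exp_pos _).le) hi (.of_forall hpt)
    _ = 1 - l ^ 2 * m ^ 2 + l ^ 2 * ∫ ω, X ω ^ 2 ∂P := by
        rw [integral_add hi1 (hiX2.const_mul _),
          integral_add (integrable_const _) (hiX.const_mul _), integral_const_mul,
          integral_const_mul, integral_const]
        simp
        ring
    _ ≤ l ^ 2 * V + 1 := by nlinarith [sq_nonneg (l * m), mul_le_mul_of_nonneg_left hV (sq_nonneg l)]
    _ ≤ Real.exp (l ^ 2 * V) := Real.add_one_le_exp _

theorem measureReal_mean_sub_ge_le {Ω : Type*} [MeasurableSpace Ω] (P : Measure Ω)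
    [IsProbabilityMeasure P] {X : Ω → ℝ} (hX : Measurable X) {R V a : ℝ} (hR : ∀ ω, |X ω| ≤ R)
    (hV : ∫ ω, X ω ^ 2 ∂P ≤ V) (hV0 : 0 < V) (ha : 0 ≤ a) (haR : a * R ≤ V) (T : ℕ) :
    (Measure.pi fun _ : Fin T => P).real {ω | T * a ≤ ∑ t, (X (ω t) - ∫ x, X x ∂P)} ≤
      Real.exp (-(T * a ^ 2 / (4 * V))) := by
  set m := ∫ x, X x ∂P
  -- This `l` minimizes the Chernoff exponent `-l T a + T l² V`, with value `-T a² / (4V)`; `a R ≤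
  -- V` is what makes `2 l R ≤ 1`.
  set l := a / (2 * V)
  have hl0 : 0 ≤ l := by positivity
  have hl : |l| * (2 * R) ≤ 1 := by
    rw [abs_of_nonneg hl0, div_mul_eq_mul_div, div_le_one (by positivity)]
    linarith
  have hm : |m| ≤ R := by
    simpa using norm_integral_le_of_norm_le_const (μ := P) (f := X) (.of_forall hR)
  have hmeas : Measurable fun ω : Fin T → Ω => ∑ t, (X (ω t) - m) :=
    Finset.measurable_sum _ fun t _ => (hX.comp (measurable_pi_apply t)).sub_const m
  have hint : Integrable (fun ω : Fin T → Ω => Real.exp (l * ∑ t, (X (ω t) - m)))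
      (Measure.pi fun _ => P) := by
    refine .of_bound (hmeas.const_mul l).exp.aestronglyMeasurable
      (Real.exp (l * ∑ _t : Fin T, (2 * R))) (.of_forall fun ω => ?_)
    rw [Real.norm_eq_abs, Real.abs_exp]
    refine Real.exp_le_exp.2 (mul_le_mul_of_nonneg_left (Finset.sum_le_sum fun t _ => ?_) hl0)
    linarith [(abs_le.1 (hR (ω t))).2, (abs_le.1 hm).1]
  refine (ProbabilityTheory.measure_ge_le_exp_mul_mgf (T * a) hl0 hint).trans ?_
  have hmgf : ProbabilityTheory.mgf (fun ω : Fin T → Ω => ∑ t, (X (ω t) - m))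
      (Measure.pi fun _ => P) l = (∫ x, Real.exp (l * (X x - m)) ∂P) ^ T := by
    rw [ProbabilityTheory.mgf]
    simp only [Finset.mul_sum, Real.exp_sum]
    rw [integral_fintype_prod_eq_prod (fun (_ : Fin T) x => Real.exp (l * (X x - m)))]
    simp
  rw [hmgf]
  have hle := pow_le_pow_left₀ (integral_nonneg fun _ => (Real.exp_pos _).le)
    (integral_exp_sub_mean_le P hX hR hV hl) T
  refine (mul_le_mul_of_nonneg_left hle (Real.exp_pos _).le).trans ?_
  rw [← Real.exp_nat_mul, ← Real.exp_add]
  refine Real.exp_le_exp.2 (le_of_eq ?_)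
  simp only [l]
  field_simp
  ring

/-- Bernstein's inequality for the mean of independent copies of a bounded random variable. -/
theorem measureReal_abs_mean_sub_ge_le {Ω : Type*} [MeasurableSpace Ω] (P : Measure Ω)
    [IsProbabilityMeasure P] {X : Ω → ℝ} (hX : Measurable X) {R V a : ℝ} (hR : ∀ ω, |X ω| ≤ R)
    (hV : ∫ ω, X ω ^ 2 ∂P ≤ V) (hV0 : 0 < V) (ha : 0 ≤ a) (haR : a * R ≤ V) {T : ℕ} (hT : 0 < T) :
    (Measure.pi fun _ : Fin T => P).real
        {ω | a ≤ |(T : ℝ)⁻¹ * ∑ t, X (ω t) - ∫ x, X x ∂P|} ≤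
      2 * Real.exp (-(T * a ^ 2 / (4 * V))) := by
  have hT' : (0 : ℝ) < T := by exact_mod_cast hT
  have h1 := measureReal_mean_sub_ge_le P hX hR hV hV0 ha haR T
  have h2 := measureReal_mean_sub_ge_le P hX.neg (X := fun ω => -X ω) (fun ω => by simpa using hR ω)
    (by simpa using hV) hV0 ha haR T
  rw [two_mul]
  refine le_trans ?_ ((measureReal_union_le _ _).trans (add_le_add h1 h2))
  refine measureReal_mono fun ω hω => ?_
  simp only [Set.mem_ofPred_eq, Set.mem_union, integral_neg, Finset.sum_sub_distrib,
    Finset.sum_neg_distrib, Finset.sum_const, Finset.card_univ, Fintype.card_fin,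
    nsmul_eq_mul] at hω ⊢
  have hS : ∑ t, X (ω t) = T * ((T : ℝ)⁻¹ * ∑ t, X (ω t)) := by field_simp
  rcases le_abs'.1 hω with h | h
  · right
    rw [hS]
    nlinarith
  · left
    rw [hS]
    nlinarith

/-! ### Elementary estimates -/

/-- Write `A - B t = (A - F t) - (B - F) t`: the unknown `F` cancels and the numerator is at most
`(1 + κ) a ≤ ε F₀ / 2`, while `B ≥ F₀ / 2`. -/
theorem abs_div_sub_le {A B F F₀ t a κ ε : ℝ} (hA : |A - F * t| ≤ a) (hB : |B - F| ≤ κ * a)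
    (ht : |t| ≤ 1) (hF₀ : 0 < F₀) (hF : F₀ ≤ F) (ha : (1 + κ) * a ≤ ε * F₀ / 2) (ha0 : 0 ≤ a)
    (hε : ε < 1) (hε0 : 0 < ε) : |A / B - t| ≤ ε := by
  have hB' : F₀ / 2 ≤ B := by
    have := (abs_le.1 hB).1
    nlinarith
  have hB0 : 0 < B := by linarith
  rw [div_sub' hB0.ne', abs_div, abs_of_pos hB0, div_le_iff₀ hB0]
  have h1 : A - B * t = (A - F * t) - (B - F) * t := by ring
  have h2 : |(B - F) * t| ≤ κ * a := by
    rw [abs_mul]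
    exact (mul_le_of_le_one_right (abs_nonneg _) ht).trans hB
  rw [h1]
  have := abs_sub (A - F * t) ((B - F) * t)
  nlinarith

/-! ### Counting bounds for the variance and the union bound. -/

theorem choose_four_le {n : ℕ} (hn : 2 ≤ n) : (2 * n).choose 4 ≤ 2 * n ^ 2 * n.choose 2 := by
  obtain ⟨k, rfl⟩ := Nat.exists_eq_add_of_le' hn
  have h1 := Nat.descFactorial_eq_factorial_mul_choose (2 * (k + 2)) 4
  have h2 := Nat.descFactorial_eq_factorial_mul_choose (k + 2) 2
  have e1 : (2 * (k + 2)).descFactorial 4 = (2 * k + 1) * ((2 * k + 2) * ((2 * k + 3) * (2 * k + 4))) := by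
    simp [Nat.descFactorial_succ, Nat.descFactorial_zero, show 2 * (k + 2) - 3 = 2 * k + 1 by omega,
      show 2 * (k + 2) - 2 = 2 * k + 2 by omega, show 2 * (k + 2) - 1 = 2 * k + 3 by omega]
    ring
  have e2 : (k + 2).descFactorial 2 = (k + 1) * (k + 2) := by
    simp [Nat.descFactorial_succ, Nat.descFactorial_zero]
  rw [e1, show Nat.factorial 4 = 24 from rfl] at h1
  rw [e2, show Nat.factorial 2 = 2 from rfl] at h2
  nlinarith [mul_nonneg (Nat.zero_le k) (Nat.zero_le (k ^ 3)), Nat.zero_le (k ^ 2), Nat.zero_le (k^3)]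

theorem choose_two_le {n : ℕ} (hn : 2 ≤ n) : (2 * n).choose 2 ≤ 2 * n ^ 2 * n := by
  have h := Nat.choose_le_pow (2 * n) 2
  nlinarith [Nat.choose_two_right (2 * n)]

theorem choose_div_card_diagSets_le {n m : ℕ} (hn : 2 ≤ n) (hm : m = 2 ∨ m = 4) :
    ((2 * n).choose m : ℝ) / (diagSets n m).card ≤ 2 * n ^ 2 := by
  rcases hm with rfl | rfl
  · have h := le_card_diagSets_two n
    have h2 := (choose_two_le hn).trans (Nat.mul_le_mul_left _ h)
    rw [div_le_iff₀ (by exact_mod_cast (by omega : 0 < (diagSets n 2).card))]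
    exact_mod_cast h2
  · have h := le_card_diagSets_four n
    have h2 := (choose_four_le hn).trans (Nat.mul_le_mul_left _ h)
    have h3 := Nat.choose_pos hn
    rw [div_le_iff₀ (by exact_mod_cast (by omega : 0 < (diagSets n 4).card))]
    exact_mod_cast h2

/-- The number of one- and two-body Majorana operators. -/
theorem card_filter_card_le (n : ℕ) (hn : 2 ≤ n) :
    ((Finset.univ : Finset (Finset (Fin (2 * n)))).filter
      fun s => s.card = 2 ∨ s.card = 4).card ≤ 32 * n ^ 4 := by
  classical
  have h : ∀ k, ((Finset.univ : Finset (Finset (Fin (2 * n)))).filter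
      fun s => s.card = k).card ≤ (2 * n) ^ k := fun k => by
    rw [← Finset.powerset_univ, ← Finset.powersetCard_eq_filter, Finset.card_powersetCard]
    simpa using Nat.choose_le_pow (2 * n) k
  rw [Finset.filter_or]
  refine (Finset.card_union_le _ _).trans ((Nat.add_le_add (h 2) (h 4)).trans ?_)
  have : n ^ 2 * 4 ≤ n ^ 2 * n ^ 2 := Nat.mul_le_mul_left _ (by nlinarith)
  nlinarith

theorem idealSym4_eq (n η : ℕ) : idealSym4 n η = idealSym2 n η ^ 2 - n / 4 := by
  rw [idealSym4, idealSym2, Nat.cast_choose_two]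
  ring

theorem sq_div_abs_idealSym4_le {n η : ℕ} {c : ℝ} (hc : 0 < c) (hn : 2 ≤ n)
    (h2 : c * n ≤ |idealSym2 n η|) (h4 : idealSym4 n η ≠ 0) :
    (n : ℝ) ^ 2 / (4 * |idealSym4 n η|) ≤ 1 / (2 * c ^ 2) + 1 / (4 * c ^ 4) := by
  have hn0 : (0 : ℝ) < n := by exact_mod_cast (by omega : 0 < n)
  have hsq : c ^ 2 * n ^ 2 ≤ idealSym2 n η ^ 2 := by
    rw [← sq_abs (idealSym2 n η), ← mul_pow]
    exact pow_le_pow_left₀ (by positivity) h2 2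
  have h4' : 0 < |idealSym4 n η| := abs_pos.2 h4
  -- If `c² n ≥ 1/2`, the term `s₂² ≥ c² n²` in `s₄ = s₂² - n/4` is at least twice `n/4`. Otherwise
  -- `n ≤ 1/(2c²)`, and integrality of `4 s₄ ≠ 0` gives `|s₄| ≥ 1/4`.
  rcases le_total (1 / 2) (c ^ 2 * n) with h | h
  · have : c ^ 2 * n ^ 2 / 2 ≤ |idealSym4 n η| := by
      refine le_trans ?_ (le_abs_self _)
      rw [idealSym4_eq]
      nlinarith
    have h5 : (n : ℝ) ^ 2 / (4 * |idealSym4 n η|) ≤ 1 / (2 * c ^ 2) := by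
      rw [div_le_div_iff₀ (by positivity) (by positivity)]
      nlinarith
    have : 0 < 1 / (4 * c ^ 4) := by positivity
    linarith
  · have hq : 1 / 4 ≤ |idealSym4 n η| := by
      have hz : 4 * idealSym4 n η = (((2 * η - n) ^ 2 - n : ℤ) : ℝ) := by
        rw [idealSym4_eq, idealSym2]
        push_cast
        ring
      have hz0 : ((2 * η - n) ^ 2 - n : ℤ) ≠ 0 := by
        intro h0
        rw [h0, Int.cast_zero] at hz
        exact h4 (by linarith)
      have := Int.one_le_abs hz0
      have h6 : (1 : ℝ) ≤ |4 * idealSym4 n η| := by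
        rw [hz]
        exact_mod_cast this
      rw [abs_mul, abs_of_pos (by norm_num : (0 : ℝ) < 4)] at h6
      linarith
    have h5 : (n : ℝ) ^ 2 / (4 * |idealSym4 n η|) ≤ 1 / (4 * c ^ 4) := by
      rw [div_le_div_iff₀ (by positivity) (by positivity)]
      have : (c ^ 2 * n) ^ 2 ≤ (1 / 2) ^ 2 := pow_le_pow_left₀ (by positivity) h 2
      nlinarith
    have : 0 < 1 / (2 * c ^ 2) := by positivity
    linarith

/-! ### Estimates computed from the empirical shadow -/

/-- The empirical mean of the single-shot estimates of `Γ_s`. -/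
def meanEstimate {n T : ℕ} {G : Subgroup (Orth n)} (ω : Fin T → G × Bits n)
    (s : Finset (Fin (2 * n))) : ℝ := (T : ℝ)⁻¹ * ∑ t, shotEstimate s (ω t)

theorem trace_majorana_shadowMean {n T : ℕ} {G : Subgroup (Orth n)} (ω : Fin T → G × Bits n)
    (s : Finset (Fin (2 * n))) :
    (majorana s * shadowMean ω).trace = (meanEstimate ω s : ℂ) := by
  rw [shadowMean, mul_smul_comm, Matrix.trace_smul, Finset.mul_sum, Matrix.trace_sum, meanEstimate]
  simp [trace_majorana_snapshot_eq]

/-- `S` is `w` times a sum of operators damped by the same `F`, so `tr(S σ)/v` deviates from `F` by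
at most `|w| |I| a / |v| ≤ κ a`. -/
theorem norm_adjustedEstimate_sub_le {n : ℕ} {ι : Type*} (I : Finset ι)
    (u : ι → Finset (Fin (2 * n))) (w : ℝ) {S ρ σ : Op n} (hS : S = (w : ℂ) • ∑ i ∈ I, majorana (u i))
    {s : Finset (Fin (2 * n))} {A r : Finset (Fin (2 * n)) → ℝ} {v F F₀ a κ ε : ℝ}
    (hσ : ∀ s, (majorana s * σ).trace = (A s : ℂ)) (hρ : ∀ s, (majorana s * ρ).trace = (r s : ℂ))
    (hr : |r s| ≤ 1) (hv : (S * ρ).trace = v) (hv0 : v ≠ 0)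
    (hA : |A s - F * r s| ≤ a) (hAu : ∀ i ∈ I, |A (u i) - F * r (u i)| ≤ a)
    (hκ : |w| * I.card / |v| ≤ κ) (hF₀ : 0 < F₀) (hF : F₀ ≤ F) (ha : (1 + κ) * a ≤ ε * F₀ / 2)
    (ha0 : 0 ≤ a) (hε : ε < 1) (hε0 : 0 < ε) :
    ‖adjustedEstimate S v (majorana s) σ - (majorana s * ρ).trace‖ ≤ ε := by
  have hexp : ∀ (τ : Op n) (x : Finset (Fin (2 * n)) → ℝ),
      (∀ s, (majorana s * τ).trace = (x s : ℂ)) →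
      (S * τ).trace = ((w * ∑ i ∈ I, x (u i) : ℝ) : ℂ) := by
    intro τ x hx
    rw [hS, smul_mul_assoc, Matrix.trace_smul, Finset.sum_mul, Matrix.trace_sum]
    simp [hx]
  have hv' : v = w * ∑ i ∈ I, r (u i) := by
    rw [hexp ρ r hρ] at hv
    exact_mod_cast hv.symm
  rw [adjustedEstimate, hexp σ A hσ, hσ, hρ, ← Complex.ofReal_div, ← Complex.ofReal_div,
    ← Complex.ofReal_sub, Complex.norm_real, Real.norm_eq_abs]
  refine abs_div_sub_le hA ?_ hr hF₀ hF ha ha0 hε hε0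
  have h1 : w * ∑ i ∈ I, A (u i) - F * v = w * ∑ i ∈ I, (A (u i) - F * r (u i)) := by
    rw [hv', Finset.sum_sub_distrib, ← Finset.mul_sum]
    ring
  have h2 : |w * ∑ i ∈ I, A (u i) - F * v| ≤ |w| * (I.card * a) := by
    rw [h1, abs_mul]
    refine mul_le_mul_of_nonneg_left ?_ (abs_nonneg _)
    refine (Finset.abs_sum_le_sum_abs _ _).trans ?_
    simpa using Finset.sum_le_card_nsmul I _ a hAu
  have hv1 : 0 < |v| := abs_pos.2 hv0
  rw [div_sub' hv0, abs_div, mul_comm v F, div_le_iff₀ hv1]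
  rw [div_le_iff₀ hv1] at hκ
  calc _ ≤ |w| * (I.card * a) := h2
    _ = |w| * I.card * a := by ring
    _ ≤ κ * |v| * a := mul_le_mul_of_nonneg_right hκ ha0
    _ = _ := by ring

/-- The exponent 10 is `4 + 6`: four powers of `n` pay for the number of operators, and `n⁶ ≥ 64`
absorbs the constant. -/
theorem union_bound_le {n : ℕ} (hn : 2 ≤ n) {δ x : ℝ} (hδ : 0 < δ) (hδ1 : δ < 1)
    (hx : 10 * Real.log (n / δ) ≤ x) : 32 * (n : ℝ) ^ 4 * (2 * Real.exp (-x)) ≤ δ := by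
  have hn2 : (2 : ℝ) ≤ n := by exact_mod_cast hn
  have hq : 0 < (n : ℝ) / δ := by positivity
  have h1 : Real.exp (-x) ≤ (((n : ℝ) / δ) ^ 10)⁻¹ := by
    rw [← Real.exp_log (pow_pos hq 10), ← Real.exp_neg, Real.log_pow]
    exact Real.exp_le_exp.2 (by push_cast; linarith)
  have h2 : (((n : ℝ) / δ) ^ 10)⁻¹ ≤ δ * ((n : ℝ) ^ 10)⁻¹ := by
    rw [div_pow, inv_div, div_eq_mul_inv]
    refine mul_le_mul_of_nonneg_right ?_ (by positivity)
    exact pow_le_of_le_one hδ.le hδ1.le (by norm_num)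
  have h3 : 64 * (n : ℝ) ^ 4 ≤ n ^ 10 := by
    have : (2 : ℝ) ^ 6 ≤ n ^ 6 := pow_le_pow_left₀ (by norm_num) hn2 6
    nlinarith [pow_pos (by linarith : (0 : ℝ) < n) 4]
  calc 32 * (n : ℝ) ^ 4 * (2 * Real.exp (-x))
      ≤ 32 * (n : ℝ) ^ 4 * (2 * (δ * ((n : ℝ) ^ 10)⁻¹)) := by
        gcongr
        exact h1.trans h2
    _ = δ * ((64 * (n : ℝ) ^ 4) * ((n : ℝ) ^ 10)⁻¹) := by ring
    _ ≤ δ * 1 := by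
        refine mul_le_mul_of_nonneg_left ?_ hδ.le
        rwa [← div_eq_mul_inv, div_le_one (by positivity)]
    _ = δ := mul_one δ

/-- With high probability, all one- and two-body mean estimates are close to their damped values
`F tr(Γ_s ρ)`. -/
theorem ofReal_le_measure_meanEstimate {n : ℕ} (hn : 2 ≤ n) {G : Subgroup (Orth n)}
    [MeasurableSpace G] [BorelSpace G] [CompactSpace G] (μ : Measure G) [μ.IsHaarMeasure]
    [IsProbabilityMeasure μ] (hG : ∀ Q : Orth n, IsSignedPerm Q → Q ∈ G) {ρ : Op n}
    (hρ : IsState ρ) {E : Op n →ₗ[ℂ] Op n} (hE : IsChannel E) {a δ : ℝ} (ha : 0 ≤ a) (ha1 : a ≤ 1)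
    (hδ : 0 < δ) (hδ1 : δ < 1) {T : ℕ} (hT : 0 < T)
    (hTa : 10 * Real.log (n / δ) ≤ T * a ^ 2 / (4 * (2 * n ^ 2))) :
    ENNReal.ofReal (1 - δ) ≤ Measure.pi (fun _ : Fin T => shotLaw μ ρ E)
      {ω | ∀ s : Finset (Fin (2 * n)), s.card = 2 ∨ s.card = 4 →
        |meanEstimate ω s - noiseRatio E s.card * (majorana s * ρ).trace.re| ≤ a} := by
  classical
  have := isProbabilityMeasure_shotLaw μ hρ hE
  set P := Measure.pi (fun _ : Fin T => shotLaw μ ρ E)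
  have hX : ∀ s, Measurable (shotEstimate s : G × Bits n → ℝ) := fun s =>
    measurable_of_continuous_left (continuous_shotEstimate s)
  set I := (Finset.univ : Finset (Finset (Fin (2 * n)))).filter fun s => s.card = 2 ∨ s.card = 4
  let bad : Finset (Fin (2 * n)) → Set (Fin T → G × Bits n) := fun s =>
    {ω | a ≤ |(T : ℝ)⁻¹ * ∑ t, shotEstimate s (ω t) - ∫ x, shotEstimate s x ∂shotLaw μ ρ E|}
  have hmb : ∀ s, MeasurableSet (bad s) := fun s => by
    refine measurableSet_le measurable_const ((Measurable.sub_const ?_ _).abs)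
    exact (Finset.measurable_sum _ fun t _ => (hX s).comp (measurable_pi_apply t)).const_mul _
  have hbad : ∀ s ∈ I, P.real (bad s) ≤ 2 * Real.exp (-(T * a ^ 2 / (4 * (2 * n ^ 2)))) := by
    intro s hs
    have hc := choose_div_card_diagSets_le hn (Finset.mem_filter.1 hs).2
    refine measureReal_abs_mean_sub_ge_le _ (hX s) (abs_shotEstimate_le s)
      ((integral_shotEstimate_sq μ hG hρ hE s).trans_le hc) ?_ ha ?_ hT
    · have : 0 < n := by omega
      positivity
    -- The range bound and the second moment are the same number `1/f_λ`, so `a ≤ 1` already yields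
    -- `a R ≤ V`.
    · exact (mul_le_of_le_one_left (by positivity) ha1).trans hc
  have hun : P.real (⋃ s ∈ I, bad s) ≤ δ := by
    refine (measureReal_biUnion_finset_le I bad).trans ((Finset.sum_le_card_nsmul I _ _ hbad).trans ?_)
    rw [nsmul_eq_mul]
    refine le_trans ?_ (union_bound_le hn hδ hδ1 hTa)
    refine mul_le_mul_of_nonneg_right ?_ (by positivity)
    exact_mod_cast card_filter_card_le n hn
  have hm : MeasurableSet (⋃ s ∈ I, bad s) := Finset.measurableSet_biUnion I fun s _ => hmb s
  have hcompl : 1 - δ ≤ P.real (⋃ s ∈ I, bad s)ᶜ := by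
    rw [probReal_compl_eq_one_sub hm]
    linarith
  refine (ENNReal.ofReal_le_of_le_toReal hcompl).trans (measure_mono fun ω hω s hs => ?_)
  by_contra! h
  refine hω (Set.mem_iUnion₂.2 ⟨s, Finset.mem_filter.2 ⟨Finset.mem_univ s, hs⟩, ?_⟩)
  simp only [bad, Set.mem_ofPred_eq, integral_shotEstimate μ hG hρ hE]
  exact h.le

end

end FermionShadow

/-! ### The sampling bound: choice of constants and conclusion. -/

theorem theorem1 :
    ∃ K : ℝ, ∀ c : ℝ, 0 < c → ∃ C : ℝ, 0 < C ∧
      ∀ (n : ℕ), 2 ≤ n →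
      -- the matchgate ensemble: a closed group between `B(2n)` and `O(2n)`, with its Haar measure
      ∀ (G : Subgroup (Orth n)) [MeasurableSpace G] [BorelSpace G] (μ : Measure G)
        [μ.IsHaarMeasure] [IsProbabilityMeasure μ],
      IsClosed (G : Set (Orth n)) → (∀ Q : Orth n, IsSignedPerm Q → Q ∈ G) →
      -- an `n`-mode state with `η` particles
      ∀ (ρ : Op n) (η : ℕ), IsState ρ → numberOp n * ρ = (η : ℂ) • ρ →
      c * n ≤ |idealSym2 n η| → idealSym4 n η ≠ 0 →
      -- the noise channel
      ∀ E : Op n →ₗ[ℂ] Op n, IsChannel E → 0 < noiseStrength E →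
      -- the symmetry values are known a priori
      (sym2 n * ρ).trace = idealSym2 n η ∧ (sym4 n * ρ).trace = idealSym4 n η ∧
      -- the sampling bound
      ∀ (ε δ : ℝ), 0 < ε → ε < 1 → 0 < δ → δ < 1 →
      ∀ T : ℕ, C * (n : ℝ) ^ 2 * Real.log (n / δ) * (ε ^ 2)⁻¹ * (noiseStrength E ^ 2)⁻¹ ≤ T →
        ENNReal.ofReal (1 - δ) ≤ Measure.pi (fun _ : Fin T => shotLaw μ ρ E)
          {ω | (∀ s : Finset (Fin (2 * n)), s.card = 2 →
                ‖adjustedEstimate (sym2 n) (idealSym2 n η) (majorana s) (shadowMean ω)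
                  - (majorana s * ρ).trace‖ ≤ ε + K * ε ^ 2) ∧
              (∀ s : Finset (Fin (2 * n)), s.card = 4 →
                ‖adjustedEstimate (sym4 n) (idealSym4 n η) (majorana s) (shadowMean ω)
                  - (majorana s * ρ).trace‖ ≤ ε + K * ε ^ 2)} := by
  refine ⟨0, fun c hc => ?_⟩
  -- The first summand serves `S₂`, the other two serve `S₄`; a single `κ` covers both degrees.
  set κ : ℝ := 1 / (2 * c) + (1 / (2 * c ^ 2) + 1 / (4 * c ^ 4)) with hκdef
  have hκ0 : 0 < κ := by positivity
  -- `320 = 10 · 8 · 4`: the union-bound exponent 10, the Bernstein denominator `4V = 8n²`, and the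
  -- 4 from squaring `a = ε F / (2(1 + κ))`.
  refine ⟨320 * (1 + κ) ^ 2, by positivity, ?_⟩
  intro n hn G _ _ μ _ _ hGc hG ρ η hρ hN h2 h4 E hE hF
  have hn0 : (0 : ℝ) < n := by exact_mod_cast (by omega : 0 < n)
  have hs2 := trace_sym2_mul hρ.2 hN
  have hs4 := trace_sym4_mul hρ.2 hN
  refine ⟨hs2, hs4, ?_⟩
  intro ε δ hε hε1 hδ hδ1 T hT
  have := compactSpace_orth n
  have : CompactSpace G := isCompact_iff_compactSpace.1 hGc.isCompact
  have hF2 : noiseStrength E ≤ noiseRatio E 2 := min_le_left _ _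
  have hF4 : noiseStrength E ≤ noiseRatio E 4 := min_le_right _ _
  have hF1 : noiseStrength E ≤ 1 := hF2.trans (noiseRatio_le_one hE 2)
  set F := noiseStrength E
  have hlog : 0 < Real.log (n / δ) := by
    refine Real.log_pos ?_
    rw [one_lt_div hδ]
    exact hδ1.trans_le (by exact_mod_cast (by omega : 1 ≤ n))
  have hT0 : 0 < T := by
    have : (0 : ℝ) < T := lt_of_lt_of_le (by positivity) hT
    exact_mod_cast this
  set a := ε * F / (2 * (1 + κ)) with hadef
  have ha0 : 0 ≤ a := by positivity
  have ha : (1 + κ) * a ≤ ε * F / 2 := le_of_eq (by rw [hadef]; field_simp)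
  have ha1 : a ≤ 1 := by
    rw [hadef, div_le_one (by positivity)]
    nlinarith
  have hTa : 10 * Real.log (n / δ) ≤ T * a ^ 2 / (4 * (2 * n ^ 2)) := by
    rw [le_div_iff₀ (by positivity)]
    calc 10 * Real.log (n / δ) * (4 * (2 * n ^ 2))
        = (320 * (1 + κ) ^ 2 * (n : ℝ) ^ 2 * Real.log (n / δ) * (ε ^ 2)⁻¹ * (F ^ 2)⁻¹) * a ^ 2 := by
          rw [hadef]
          field_simp
          ring
      _ ≤ T * a ^ 2 := mul_le_mul_of_nonneg_right hT (sq_nonneg a)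
  refine (ofReal_le_measure_meanEstimate hn μ hG hρ hE ha0 ha1 hδ hδ1 hT0 hTa).trans
    (measure_mono fun ω hω => ?_)
  have hr : ∀ s : Finset (Fin (2 * n)),
      (majorana s * ρ).trace = (((majorana s * ρ).trace.re : ℝ) : ℂ) := fun s =>
    (trace_majorana_mul_state hρ s).1.symm
  have hr1 : ∀ s : Finset (Fin (2 * n)), |(majorana s * ρ).trace.re| ≤ 1 := fun s =>
    (trace_majorana_mul_state hρ s).2
  have hs20 : 0 < |idealSym2 n η| := lt_of_lt_of_le (by positivity) h2
  constructor
  · intro s hs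
    have hωs : ∀ u : Finset (Fin (2 * n)), u.card = 2 →
        |meanEstimate ω u - noiseRatio E 2 * (majorana u * ρ).trace.re| ≤ a := fun u hu => by
      have := hω u (Or.inl hu)
      rwa [hu] at this
    have hκ : |(-(1 / 2) : ℝ)| * (Finset.univ : Finset (Fin n)).card / |idealSym2 n η| ≤ κ := by
      refine le_trans ?_ (le_add_of_nonneg_right (by positivity))
      rw [div_le_div_iff₀ hs20 (by positivity)]
      simp only [Finset.card_univ, Fintype.card_fin, abs_neg]
      rw [abs_of_pos (by norm_num)]
      linarith
    rw [zero_mul, add_zero]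
    exact norm_adjustedEstimate_sub_le Finset.univ pairSet (-(1 / 2))
      (by rw [sym2_eq]; push_cast; rfl) (trace_majorana_shadowMean ω) hr (hr1 s) hs2
      (abs_pos.1 hs20) (hωs s hs) (fun p _ => hωs _ (card_pairSet p)) hκ hF hF2 ha ha0 hε1 hε
  · intro s hs
    have hωs : ∀ u : Finset (Fin (2 * n)), u.card = 4 →
        |meanEstimate ω u - noiseRatio E 4 * (majorana u * ρ).trace.re| ≤ a := fun u hu => by
      have := hω u (Or.inr hu)
      rwa [hu] at this
    -- Ordered pairs of distinct modes, at most `n²` of them, each weighted `1/4` in `S₄`.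
    let I : Finset (Σ _ : Fin n, Fin n) := Finset.univ.sigma fun p => Finset.univ.erase p
    have hI : (I.card : ℝ) ≤ n ^ 2 := by
      have : I.card ≤ (Finset.univ : Finset (Σ _ : Fin n, Fin n)).card := Finset.card_le_univ I
      rw [Finset.card_univ, Fintype.card_sigma] at this
      simp only [Fintype.card_fin, Finset.sum_const, Finset.card_univ, smul_eq_mul] at this
      rw [sq]
      exact_mod_cast this
    have hκ : |(1 / 4 : ℝ)| * I.card / |idealSym4 n η| ≤ κ := by
      have h := sq_div_abs_idealSym4_le hc hn h2 h4
      have h' : 0 < 1 / (2 * c) := by positivity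
      have h4' : 0 < |idealSym4 n η| := abs_pos.2 h4
      have : |(1 / 4 : ℝ)| * I.card / |idealSym4 n η| ≤ (n : ℝ) ^ 2 / (4 * |idealSym4 n η|) := by
        rw [div_le_div_iff₀ h4' (by positivity), abs_of_pos (by norm_num)]
        nlinarith
      rw [hκdef]
      linarith
    rw [zero_mul, add_zero]
    refine norm_adjustedEstimate_sub_le I (fun x => pairSet x.1 ∪ pairSet x.2) (1 / 4)
      ?_ (trace_majorana_shadowMean ω) hr (hr1 s) hs4 h4 (hωs s hs)
      (fun x hx => hωs _ (card_pairSet_union ?_)) hκ hF hF4 ha ha0 hε1 hε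
    · rw [sym4_eq, Finset.sum_sigma]
      push_cast
      rfl
    · exact (Finset.ne_of_mem_erase (Finset.mem_sigma.1 hx).2).symm
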